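/- **Model.** A network is a connected undirected graph $G=(V,E)$ with $n=|V|\ge 2$ nodes and diameter $D$. The nodes carry distinct identifiers, which are integers in $[0,L-1]$, and $k\ge 1$ of them, the sources, each hold a message, an integer in $[0,M-1]$; messages need not be distinct. Initially a node knows only its own identifier and, if it is a source, its own message; it knows none of $n,D,L,M,k$. Time proceeds in synchronous steps, starting at all nodes simultaneously. In each step every node that has not terminated either beeps or listens, as a deterministic function of its input and of what it has heard so far; a listening node hears a beep iff at least one of its neighbours beeps, and it cannot distinguish one beeping neighbour from several. *Multi-broadcast without provenance* is the task in which every node has to terminate with the set of distinct source messages as output. A *leader election procedure in time $O(D\log L)$* makes all nodes terminate in the same step, with the highest identifier as output, after at most $c\,D\log_2 L$ steps for an absolute constant $c$. **Algorithm** *Multi-Broadcast Without Provenance* (with a given leader election procedure as a subroutine). 1. Elect the node $v$ with the highest identifier as leader. Let $v$ determine and broadcast an estimate of the diameter, again denoted $D$, by measuring the time until the acknowledgements of all nodes have returned. Let $v$ collect the superposition (bitwise OR) of strings $1\cdots1$, as long as the messages of the sources, and broadcast the largest message length $p$. 2. For each bit $i=1,2,\dots$ of the identifiers, let the sources send to $v$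 a string with two positions for each known $(i-1)$-bit prefix of source identifiers, with a single $1$ at the position of the source's own $i$-bit prefix; $v$ collects the superposition of these strings and broadcasts it by a beep wave, after which all nodes know all $i$-bit prefixes. Abort this as soon as the number of known prefixes exceeds the estimate of $D$. If it is not aborted, the sources finally send their messages to $v$, each in its own block of $p$ bits (the blocks being ordered by identifier), $v$ broadcasts the superposition, and all nodes terminate. 3. If step 2 was aborted, perform the same rounds on the $p$ bits of the source messages instead of the identifiers; after $p$ rounds all nodes know the set of messages and terminate. **Theorem.** There are a leader election procedure in time $O(D\log L)$ and an absolute constant $C$ such that, in every network as above, the algorithm Multi-Broadcast Without Provenance, run with this procedure, correctly performs multi-broadcast without provenance, and all nodes have terminated within $$C\Big(k\Big\lceil\log_2\frac Mk\Big\rceil+D\log_2 L\Big)\ \text{ time-steps if } k<M,\qquad C\big(M+D\log_2 L\big)\ \text{ time-steps if } k\ge M .$$ -/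

import Mathlib

/-!
The synchronous beep model, the procedures from which multi-broadcast is assembled, and the
algorithm *Multi-Broadcast Without Provenance*.
-/

namespace BeepModel

/-! ### The beep model -/

/-- What a node does in a time-step: it beeps, it listens, or it has terminated with an output. -/
inductive Action (α : Type) where
  | beep : Action α
  | listen : Action α
  | halt (a : α) : Action α

/-- `true` exactly for `beep`. -/
def Action.isBeep {α : Type} : Action α → Bool
  | .beep => true
  | _ => false

/-- `true` exactly for `listen`. -/
def Action.isListen {α : Type} : Action α → Bool
  | .listen => true
  | _ => false

/-- `true` exactly for `halt`. -/
def Action.isHalt {α : Type} : Action α → Bool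
  | .halt _ => true
  | _ => false

/-- Beep if the bit is `true`, listen otherwise. -/
def Action.ofBit {α : Type} (b : Bool) : Action α := if b then .beep else .listen

/-- A deterministic program of one node with outputs in `α`: the next action as a function of what
the node has heard so far.  The history lists, oldest first, for every past time-step whether the
node heard a beep in it (`false` for a time-step in which the node itself beeped). -/
def Protocol (α : Type) : Type := List Bool → Action α

/-- Run `p` until it halts with output `a`, then run `f a` on the history from then on. -/
def Protocol.andThen {α β : Type} (p : Protocol α) (f : α → Protocol β) : Protocol β
  | [] => match p [] with
    | .beep => .beep
    | .listen => .listen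
    | .halt a => f a []
  | b :: h => match p [] with
    | .halt a => f a (b :: h)
    | _ => Protocol.andThen (fun h' => p (b :: h')) f h

instance : Monad Protocol where
  pure a := fun _ => .halt a
  bind := Protocol.andThen

section Execution

variable {V : Type} [Fintype V] (G : SimpleGraph V) [DecidableRel G.Adj] {α : Type}
  (P : V → Protocol α)

/-- The history of node `v` after `t` time-steps of the execution in which node `u` runs `P u`: a
listening node hears a beep iff at least one of its neighbours beeps, a beeping node hears nothing,
and the history of a node that has halted no longer changes (so that it stays halted). -/
def history : ℕ → V → List Bool
  | 0, _ => []
  | t + 1, v =>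
    if (P v (history t v)).isHalt then history t v
    else history t v ++ [(P v (history t v)).isListen &&
      decide (∃ u, G.Adj v u ∧ (P u (history t u)).isBeep = true)]

/-- The action of node `v` after `t` time-steps have elapsed. -/
def actionAt (t : ℕ) (v : V) : Action α := P v (history G P t v)

/-- Within the first `t` time-steps, node `v` has terminated with output `a`. -/
def OutputsWithin (t : ℕ) (v : V) (a : α) : Prop := actionAt G P t v = .halt a

/-- Node `v` terminates with output `a` after exactly `t` time-steps. -/
def OutputsAt (t : ℕ) (v : V) (a : α) : Prop :=
  actionAt G P t v = .halt a ∧ ∀ s < t, (actionAt G P s v).isHalt = false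

end Execution

/-! ### Bit strings -/

/-- The `w` lowest binary digits of `x`, most significant first. -/
def toBits (w x : ℕ) : List Bool := (List.range w).map fun i => x.testBit (w - 1 - i)

/-- The number with the given binary digits, most significant first. -/
def ofBits (s : List Bool) : ℕ := s.foldl (fun x b => 2 * x + b.toNat) 0

/-- Was a beep heard in time-step `i` (counted from `0`)? -/
def heard (h : List Bool) (i : ℕ) : Bool := h.getD i false

/-- The index of the first heard beep. -/
def firstHeard (h : List Bool) : Option ℕ := h.findIdx? id

/-- At least three time-steps have elapsed, and the node neither heard nor emitted a beep in the last
three of them; `beeped t` tells whether it emitted a beep in time-step `t`. -/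
def quiet (h : List Bool) (beeped : ℕ → Bool) : Bool :=
  decide (3 ≤ h.length) && [1, 2, 3].all fun i =>
    !heard h (h.length - i) && !beeped (h.length - i)

/-- The self-delimiting code `C`: every bit is doubled, with `10` at the beginning and at the
end. -/
def encode (s : List Bool) : List Bool :=
  [true, false] ++ s.flatMap (fun b => [b, b]) ++ [true, false]

/-- Decode doubled bits up to the final `10`; `none` as long as the end has not been read. -/
def decodeBody : List Bool → Option (List Bool)
  | true :: true :: r => (decodeBody r).map (true :: ·)
  | false :: false :: r => (decodeBody r).map (false :: ·)
  | true :: false :: _ => some []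
  | _ => none

/-- Left inverse of `encode`; `none` as long as the end of the code word has not been read. -/
def decode : List Bool → Option (List Bool)
  | true :: false :: r => decodeBody r
  | _ => none

/-! ### Beep waves -/

/-- The relay rule of beep waves, on the history *newest first*: a node that heard a beep in
time-step `i` beeps in time-step `i + 1` unless it beeped itself in time-step `i - 1`. -/
def relays : List Bool → Bool
  | [] => false
  | [b] => b
  | b :: _ :: h => b && !relays h

/-- The string received by a non-source together with the time-step in which the first beep was
heard, once the end has been heard: every third time-step, from the first beep on, carries one bit
of the code word. -/
def received (h : List Bool) : Option (ℕ × List Bool) :=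
  (firstHeard h).bind fun f =>
    (decode ((List.range ((h.length - f + 2) / 3)).map fun i => heard h (f + 3 * i))).map
      fun s => (f, s)

/-- Beep wave at a non-source.  The node halts as soon as it knows the message `s` and `dur s`
time-steps have elapsed; its output is its distance from the source (if the wave and this
procedure started at the same time) and `s`. -/
def waveFollow (dur : List Bool → ℕ) : Protocol (ℕ × List Bool) := fun h =>
  match received h with
  | some (f, s) =>
    if dur s ≤ h.length then .halt (f + 1, s) else .ofBit (relays h.reverse)
  | none => .ofBit (relays h.reverse)

/-- Beep wave at the source: bit `i` of the code word of `s` is sent in time-step `3 * i`. -/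
def waveSend (dur : ℕ) (s : List Bool) : Protocol (ℕ × List Bool) := fun h =>
  if dur ≤ h.length then .halt (0, s)
  else .ofBit (h.length % 3 == 0 && heard (encode s) (h.length / 3))

/-- *Beep-Wave* from the leader, with the diameter estimate `D` known to all nodes, so that all
of them terminate at the same time.  Every node outputs its distance from the leader and the
leader's string; the argument `s` matters at the leader only. -/
def beepWave (D : ℕ) (lead : Bool) (s : List Bool) : Protocol (ℕ × List Bool) :=
  if lead then waveSend (3 * (encode s).length + D) s
  else waveFollow fun s' => 3 * (encode s').length + D

/-! ### Diameter estimation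

Time-steps are counted from `1` in this procedure, so time-step `i` is entry `i - 1` of the
history. -/

/-- First part at the leader: beep in time-step `1`; output the first time-step before which there
were three time-steps without a beep. -/
def pingLeader : Protocol ℕ := fun h =>
  if h = [] then .beep
  else if 3 ≤ h.length ∧ true ∉ h.drop (h.length - 3) then .halt (h.length + 1)
  else .listen

/-- Does a non-leader that heard its first beep in time-step `j` beep in time-step `s`?  It passes
the first beep on in time-step `j + 1`, beeps as an acknowledgement in the next time-step congruent
to `-j` modulo `3`, and relays the beeps it hears in time-steps congruent to `2 - j`. -/
def pingBeeps (h : List Bool) (j s : ℕ) : Bool :=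
  decide (s = j + 1) ||
    (decide (j < s) && decide ((s + j) % 3 = 0) && (decide (s ≤ j + 3) || heard h (s - 2)))

/-- First part at a non-leader: it ends when the node has neither heard nor emitted a beep in the
last three time-steps; the output is the number of elapsed time-steps. -/
def pingFollow : Protocol ℕ := fun h =>
  match firstHeard h with
  | none => .listen
  | some f =>
    if f + 4 ≤ h.length ∧ quiet h (fun t => pingBeeps h (f + 1) (t + 1)) = true then
      .halt h.length
    else .ofBit (pingBeeps h (f + 1) (h.length + 1))

/-- *EstimateDiameter*: the leader's estimate is the time-step `i` in which its first part ends; it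
is then broadcast by a beep wave that starts in that time-step. -/
def estimateDiameter (lead : Bool) : Protocol ℕ :=
  if lead then do
    let i ← pingLeader
    let _ ← waveSend (3 * (encode (toBits i.size i)).length + i) (toBits i.size i)
    pure i
  else do
    let t ← pingFollow
    let r ← waveFollow fun s => ofBits s - 1 + 3 * (encode s).length + ofBits s - t
    pure (ofBits r.2)

/-! ### Collection of messages at the leader -/

/-- Does a node at distance `d` from the leader, holding the string `s` (empty if it holds none),
beep in time-step `t` of a collection?  Bit `i` is sent towards the leader by the nodes at distance
`d` in time-step `3 * i + D - d`. -/
def collectBeeps (D d : ℕ) (s h : List Bool) (t : ℕ) : Bool :=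
  decide (0 < d) && decide (D ≤ t + d) && decide ((t + d - D) % 3 = 0) &&
    (heard s ((t + d - D) / 3) || (decide (0 < t) && heard h (t - 1)))

/-- Bit `i` of the superposition, as known to a leader holding the string `s` itself. -/
def collectedBit (D : ℕ) (s h : List Bool) (i : ℕ) : Bool :=
  heard s i || heard h (3 * i + D - 1)

/-- *CollectMessages*: the leader obtains the superposition (bitwise OR) of the strings, of length
at most `p`, held by the sources; `s` is the string of this node, empty if it is not a source.  The
nodes first learn their distances from the leader.  The output matters at the leader only. -/
def collectMessages (D : ℕ) (lead : Bool) (s : List Bool) (p : ℕ) : Protocol (List Bool) := do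
  let r ← beepWave D lead [true]
  (fun h =>
    if 3 * p + D ≤ h.length then .halt ((List.range p).map (collectedBit D s h))
    else .ofBit (collectBeeps D r.1 s h h.length) : Protocol (List Bool))

/-- The unbounded collection of strings `1⋯1` at the leader: it ends when the `0` that ends the
superposition has been received; the output is the number of `1`s. -/
def lengthLeader (D : ℕ) (s : List Bool) : Protocol ℕ := fun h =>
  match (List.range (h.length + 1)).find?
      (fun i => decide (3 * (i + 1) + D ≤ h.length) && !collectedBit D s h i) with
  | some i => .halt i
  | none => .listen

/-- The same at a node at distance `d ≥ 1`: it ends when, after the time of the first bit, there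
have been three time-steps in which the node neither heard nor emitted a beep; the output is the
number of elapsed time-steps. -/
def lengthFollow (D d : ℕ) (s : List Bool) : Protocol ℕ := fun h =>
  if D + 2 ≤ h.length + d ∧ quiet h (collectBeeps D d s h) = true then .halt h.length
  else .ofBit (collectBeeps D d s h h.length)

/-- *GetMessageLength*: all nodes learn the largest length `l` of the sources' messages; `l` is the
length of this node's message, `0` if it has none. -/
def getMessageLength (D : ℕ) (lead : Bool) (l : ℕ) : Protocol ℕ := do
  let r ← beepWave D lead [true]
  if lead then do
    let p ← lengthLeader D (List.replicate l true)
    let _ ← beepWave D true (toBits p.size p)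
    pure p
  else do
    let t ← lengthFollow D r.1 (List.replicate l true)
    let w ← waveFollow fun s =>
      3 * (ofBits s + 1) + D + (3 * (encode s).length + D) - t
    pure (ofBits w.2)

/-! ### Multi-broadcast -/

/-- The string in which each known prefix `x` has two positions, for `x0` and for `x1`, with a `1`
exactly at the position of `own`; the empty string for a node that is not a source. -/
def prefixString (known : List ℕ) : Option ℕ → List Bool
  | none => []
  | some own => known.flatMap fun x => [decide (own = 2 * x), decide (own = 2 * x + 1)]

/-- The extended prefixes whose position in `Z` holds a `1`. -/
def extendPrefixes (known : List ℕ) (Z : List Bool) : List ℕ :=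
  (((known.flatMap fun x => [2 * x, 2 * x + 1]).zip Z).filter Prod.snd).map Prod.fst

/-- One round of the concurrent binary searches: all nodes pass from the list of known prefixes to
the list of those prefixes, one bit longer, that occur at a source; `own` is the longer prefix of
this node's string, if it is a source. -/
def searchRound (D : ℕ) (lead : Bool) (own : Option ℕ) (known : List ℕ) :
    Protocol (List ℕ) := do
  let Z ← collectMessages D lead (prefixString known own) (2 * known.length)
  let r ← beepWave D lead Z
  pure (extendPrefixes known r.2)

/-- Search for the remaining `n` bits; prefixes are the numbers they represent in binary, and `own`
is the searched string of this node, if it is a source. -/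
def search (D : ℕ) (lead : Bool) (own : Option ℕ) : ℕ → List ℕ → Protocol (List ℕ)
  | 0, known => pure known
  | n + 1, known => do
    let known' ← searchRound D lead (own.map (· / 2 ^ n)) known
    search D lead own n known'

/-- As `search`, but aborted, with output `none`, as soon as the number of known prefixes
exceeds `cap`. -/
def searchUntil (cap D : ℕ) (lead : Bool) (own : Option ℕ) :
    ℕ → List ℕ → Protocol (Option (List ℕ))
  | 0, known => pure (if cap < known.length then none else some known)
  | n + 1, known =>
    if cap < known.length then pure none
    else do
      let known' ← searchRound D lead (own.map (· / 2 ^ n)) known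
      searchUntil cap D lead own n known'

/-- The string with one block of `p` bits for each source identifier, which holds the message in
this node's own block and is `0` elsewhere; the empty string for a node that is not a source. -/
def messageString (ids : List ℕ) (p ident : ℕ) : Option ℕ → List Bool
  | none => []
  | some m => ids.flatMap fun x => if x = ident then toBits p m else List.replicate p false

/-- The pairs (source identifier, message) read off from the blocks of the collected string. -/
def readBlocks (ids : List ℕ) (p : ℕ) (s : List Bool) : List (ℕ × ℕ) :=
  ids.zipIdx.map fun x => (x.1, ofBits ((s.drop (x.2 * p)).take p))

/-- What the nodes know after the set-up phase of multi-broadcast: whether the node is the leader,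
the highest identifier, the diameter estimate and the largest message length. -/
structure Setup where
  lead : Bool
  top : ℕ
  D : ℕ
  p : ℕ

/-- The set-up phase: leader election, diameter estimation, message length determination. -/
def setUp (elect : ℕ → Protocol ℕ) (ident : ℕ) (msg : Option ℕ) : Protocol Setup := do
  let top ← elect ident
  let D ← estimateDiameter (ident == top)
  let p ← getMessageLength D (ident == top) (msg.elim 0 Nat.size)
  pure ⟨ident == top, top, D, p⟩

/-- *Multi-Broadcast With Provenance* after its set-up phase, performed until the number of known
identifier prefixes exceeds the diameter estimate; the output is the list of all pairs (source
identifier, source message), or `none` if the procedure was aborted. -/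
def withProvenanceUntil (S : Setup) (ident : ℕ) (msg : Option ℕ) :
    Protocol (Option (List (ℕ × ℕ))) := do
  let found ← searchUntil S.D S.D S.lead (msg.map fun _ => ident) S.top.size [0]
  match found with
  | none => pure none
  | some ids => do
    let m ← collectMessages S.D S.lead (messageString ids S.p ident msg) (ids.length * S.p)
    let r ← beepWave S.D S.lead m
    pure (some (readBlocks ids S.p r.2))

/-- *Multi-Broadcast Without Provenance*, with `elect` as the leader election procedure, at the node
with identifier `ident`, whose message is `msg` (`none` if the node is not a source).  The node
starts without any further knowledge of the network, and it outputs a set of messages. -/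
def multiBroadcast (elect : ℕ → Protocol ℕ) (ident : ℕ) (msg : Option ℕ) :
    Protocol (Finset ℕ) := do
  let S ← setUp elect ident msg
  let result ← withProvenanceUntil S ident msg
  match result with
  | some pairs => pure (pairs.map Prod.snd).toFinset
  | none => do
    let msgs ← search S.D S.lead msg S.p [0]
    pure msgs.toFinset

/-! ### Specification -/

/-- `elect` performs leader election in `O(D log L)` time-steps in every connected network with at
least two nodes and distinct identifiers below `L`: all nodes terminate in the same time-step, with
the highest identifier as output.  A node knows nothing but its own identifier at the beginning. -/
def ElectsLeader (elect : ℕ → Protocol ℕ) : Prop :=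
  ∃ c : ℝ, ∀ (V : Type) [Fintype V] [Nontrivial V] (G : SimpleGraph V) [DecidableRel G.Adj]
    (ident : V → ℕ) (L : ℕ), G.Connected → Function.Injective ident → (∀ v, ident v < L) →
    ∃ T : ℕ, (T : ℝ) ≤ c * (G.diam * Real.logb 2 L) ∧
      ∀ v, OutputsAt G (fun u => elect (ident u)) T v (Finset.univ.sup ident)

end BeepModel

namespace BeepModel

/-! ### Protocols at one node, run against prescribed beeps of the neighbours. -/

section LocalRuns

variable {α β : Type}

/-! Executions. Beeps `B` that are consistent with the protocol at every node determine the
execution (`NetRun.history_eq`). So for most procedures the beep pattern is written down in closed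
form, in terms of distances from the leader, and checked locally. Distances of neighbours differ by
at most one and the beeps of successive layers fall into different residues modulo 3, so a node can
tell which layer a beep comes from. Phases that end simultaneously are composed by `NetRun.bind`.
The two phases that end at node-dependent times are followed by a beep wave which brings all nodes
back into step (`localRun_bind_waveFollow`).

Leader election. Budgets `X = 2 ^ j` are tried in turn. Within `O(X)` steps the nodes compute
proposals and verify them locally. A node that learns of no violation within distance `3 * X + 1`
can conclude that its proposal is the maximum and that every other node concludes the same
(`proposal_eq_of_checks`). Hence attempts fail or succeed unanimously, and success is certain once
`X` reaches the order of the diameter times the length of the highest identifier; doubling budgets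
cost only a constant factor more.

Running time. Put `λ = log₂ L`, let `p` be the largest message length, and let `D` be the estimate,
at most `8 * G.diam`. Set-up takes `O(D λ + p)`. A search round takes `O(D + number of known
prefixes)`. The identifier search is continued only while that number is at most `D`, so it takes
`O(D λ)` whatever `k` is, and the message blocks add `O(min D k * p)`. An abort implies `D < k`; the
search on the messages then takes `O(p D)` plus the sum of the prefix counts, which at depth `i` are
at most `min (2 ^ i) k`.

If `k < M`, put `c = ⌈log₂ (M / k)⌉`. Distinct identifiers give `k ≤ L`, so `p ≤ log₂ M + 1 ≤ 2 c +
λ` and `min D k * p ≤ 2 k c + D λ`; after an abort the left side is `D * p`. The prefix counts sum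
to at most `4 k c` by `sum_min_two_pow_le`. If `k ≥ M`, then `p ≤ 2 λ` and the prefix counts sum to
less than `2 ^ p ≤ 2 M`. -/

theorem andThen_of_running (p : Protocol α) (f : α → Protocol β) (h : List Bool)
    (hp : ∀ n < h.length, (p (h.take n)).isHalt = false) (b : Bool)
    (hb : p h = Action.ofBit b) : (p >>= f) h = Action.ofBit b := by
  change Protocol.andThen p f h = _
  induction h generalizing p with
  | nil =>
    unfold Protocol.andThen
    cases b <;> simp_all [Action.ofBit]
  | cons c h ih =>
    have h0 := hp 0 (by simp)
    have ih' := ih (fun h' => p (c :: h'))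
      (fun n hn => by simpa using hp (n + 1) (by simpa using hn)) hb
    unfold Protocol.andThen
    cases hq : p [] with
    | beep => exact ih'
    | listen => exact ih'
    | halt a => simp [hq, Action.isHalt] at h0

theorem andThen_of_halted (p : Protocol α) (f : α → Protocol β) (h₁ h₂ : List Bool)
    (hp : ∀ n < h₁.length, (p (h₁.take n)).isHalt = false) (a : α)
    (ha : p h₁ = .halt a) : (p >>= f) (h₁ ++ h₂) = f a h₂ := by
  change Protocol.andThen p f (h₁ ++ h₂) = _
  induction h₁ generalizing p with
  | nil =>
    cases h₂ <;> simp [Protocol.andThen, ha]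
  | cons c h ih =>
    have h0 := hp 0 (by simp)
    have ih' := ih (fun h' => p (c :: h'))
      (fun n hn => by simpa using hp (n + 1) (by simpa using hn)) ha
    rw [List.cons_append]
    unfold Protocol.andThen
    cases hq : p [] with
    | beep => exact ih'
    | listen => exact ih'
    | halt a => simp [hq, Action.isHalt] at h0

theorem andThen_congr_of_length_le (p : Protocol α) (f g : α → Protocol β) (h : List Bool)
    (hfg : ∀ a h', h'.length ≤ h.length → f a h' = g a h') : (p >>= f) h = (p >>= g) h := by
  change Protocol.andThen p f h = Protocol.andThen p g h
  induction h generalizing p with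
  | nil => unfold Protocol.andThen; cases p [] <;> simp [hfg]
  | cons c h ih =>
    unfold Protocol.andThen
    have := ih (fun h' => p (c :: h')) (fun a h' hh => hfg a h' (by simp; omega))
    cases p [] with
    | beep => exact this
    | listen => exact this
    | halt a => exact hfg _ _ le_rfl

/-- If `p` does not halt at once, the continuation only sees strictly shorter histories. The
strictness drives the comparison of fuels in `electLoop_congr`. -/
theorem andThen_congr_of_length_lt (p : Protocol α) (f g : α → Protocol β) (h : List Bool)
    (hp : (p []).isHalt = false)
    (hfg : ∀ a h', h'.length < h.length → f a h' = g a h') : (p >>= f) h = (p >>= g) h := by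
  cases h with
  | nil =>
    change Protocol.andThen p f [] = Protocol.andThen p g []
    unfold Protocol.andThen
    cases hq : p [] with
    | beep => rfl
    | listen => rfl
    | halt a => simp [hq, Action.isHalt] at hp
  | cons c h =>
    have := andThen_congr_of_length_le (fun h' => p (c :: h')) f g h
      (fun a h' hh => hfg a h' (by simp; omega))
    change Protocol.andThen p f _ = Protocol.andThen p g _
    unfold Protocol.andThen
    cases hq : p [] with
    | beep => exact this
    | listen => exact this
    | halt a => simp [hq, Action.isHalt] at hp

/-- The history of a node that beeps according to `B` while at least one neighbour beeps exactly in
the time-steps marked by `H`. -/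
def obs (B H : ℕ → Bool) (t : ℕ) : List Bool := (List.range t).map fun n => !B n && H n

@[simp] theorem length_obs (B H : ℕ → Bool) (t : ℕ) : (obs B H t).length = t := by simp [obs]

theorem take_obs (B H : ℕ → Bool) {n t : ℕ} (h : n ≤ t) : (obs B H t).take n = obs B H n := by
  simp [obs, ← List.map_take, List.take_range, h]

theorem obs_add (B H : ℕ → Bool) (s t : ℕ) :
    obs B H (s + t) = obs B H s ++ obs (fun n => B (s + n)) (fun n => H (s + n)) t := by
  simp [obs, List.range_add]

theorem obs_succ (B H : ℕ → Bool) (t : ℕ) :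
    obs B H (t + 1) = obs B H t ++ [!B t && H t] := by
  simp [obs, List.range_succ]

theorem obs_congr {B B' H H' : ℕ → Bool} {t : ℕ} (hB : ∀ n < t, B n = B' n)
    (hH : ∀ n < t, H n = H' n) : obs B H t = obs B' H' t := by
  refine List.map_congr_left fun n hn => ?_
  rw [List.mem_range] at hn
  rw [hB n hn, hH n hn]

theorem heard_obs (B H : ℕ → Bool) {i t : ℕ} (h : i < t) : heard (obs B H t) i = (!B i && H i) := by
  simp [heard, obs, h]

theorem heard_of_length_le {h : List Bool} {i : ℕ} (hi : h.length ≤ i) : heard h i = false := by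
  simp [heard, List.getElem?_eq_none hi]

theorem true_mem_obs (B H : ℕ → Bool) (t : ℕ) :
    true ∈ obs B H t ↔ ∃ n < t, B n = false ∧ H n = true := by
  simp [obs]

theorem isHalt_ofBit (b : Bool) : (Action.ofBit b : Action α).isHalt = false := by
  cases b <;> rfl

theorem isBeep_ofBit (b : Bool) : (Action.ofBit b : Action α).isBeep = b := by
  cases b <;> rfl

theorem isListen_ofBit (b : Bool) : (Action.ofBit b : Action α).isListen = !b := by
  cases b <;> rfl

theorem Action.eq_ofBit {x : Action α} (h : x.isHalt = false) : x = Action.ofBit x.isBeep := by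
  cases x <;> simp_all [Action.isHalt, Action.isBeep, Action.ofBit]

/-- If `H` marks the time-steps in which a neighbour beeps, then `p` beeps in the time-steps marked
by `B`, and it halts with output `a` after exactly `T` time-steps. -/
structure LocalRun (p : Protocol α) (H : ℕ → Bool) (T : ℕ) (a : α) (B : ℕ → Bool) : Prop where
  act : ∀ t < T, p (obs B H t) = Action.ofBit (B t)
  halt : p (obs B H T) = .halt a

namespace LocalRun

theorem congr {p : Protocol α} {H H' : ℕ → Bool} {T : ℕ} {a : α} {B B' : ℕ → Bool}
    (h : LocalRun p H T a B) (hB : ∀ n < T, B n = B' n) (hH : ∀ n < T, H n = H' n) :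
    LocalRun p H' T a B' := by
  constructor
  · intro t ht
    rw [← hB t ht, ← h.act t ht]
    exact congrArg p (obs_congr (fun n hn => (hB n (by omega)).symm)
      (fun n hn => (hH n (by omega)).symm))
  · rw [← h.halt]
    exact congrArg p (obs_congr (fun n hn => (hB n hn).symm) (fun n hn => (hH n hn).symm))

theorem bind {p : Protocol α} {f : α → Protocol β} {H : ℕ → Bool} {T₁ T₂ : ℕ} {a : α} {b : β}
    {B : ℕ → Bool} (h₁ : LocalRun p H T₁ a B)
    (h₂ : LocalRun (f a) (fun n => H (T₁ + n)) T₂ b fun n => B (T₁ + n)) :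
    LocalRun (p >>= f) H (T₁ + T₂) b B := by
  have key : ∀ t, (p >>= f) (obs B H (T₁ + t)) =
      f a (obs (fun n => B (T₁ + n)) (fun n => H (T₁ + n)) t) := by
    intro t
    rw [obs_add]
    refine andThen_of_halted p f _ _ (fun n hn => ?_) a h₁.halt
    rw [length_obs] at hn
    rw [take_obs _ _ hn.le, h₁.act n hn, isHalt_ofBit]
  constructor
  · intro t ht
    rcases lt_or_ge t T₁ with h | h
    · refine andThen_of_running p f _ (fun n hn => ?_) _ (h₁.act t h)
      rw [length_obs] at hn
      rw [take_obs _ _ hn.le, h₁.act n (by omega), isHalt_ofBit]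
    · obtain ⟨s, rfl⟩ := Nat.exists_eq_add_of_le h
      rw [key, h₂.act s (by omega)]
  · rw [key, h₂.halt]

theorem pure (a : α) (H B : ℕ → Bool) : LocalRun (Pure.pure a : Protocol α) H 0 a B :=
  ⟨fun _ h => absurd h (by simp), rfl⟩

end LocalRun

/-- On every history, `p` halts after exactly `T` time-steps. -/
structure Timed (p : Protocol α) (T : ℕ) : Prop where
  run : ∀ h : List Bool, h.length < T → (p h).isHalt = false
  halt : ∀ h : List Bool, h.length = T → ∃ a, p h = .halt a

theorem Timed.bind {p : Protocol α} {f : α → Protocol β} {S T : ℕ} (hp : Timed p S)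
    (hf : ∀ a, Timed (f a) T) : Timed (p >>= f) (S + T) := by
  have key : ∀ h : List Bool, S ≤ h.length → ∃ a, (p >>= f) h = f a (h.drop S) := by
    intro h hS
    obtain ⟨a, ha⟩ := hp.halt (h.take S) (by simp [hS])
    refine ⟨a, ?_⟩
    conv_lhs => rw [← List.take_append_drop S h]
    refine andThen_of_halted p f _ _ (fun n hn => hp.run _ ?_) a ha
    simp at hn ⊢
    omega
  constructor
  · intro h hh
    rcases lt_or_ge h.length S with h' | h'
    · rw [andThen_of_running p f h (fun n hn => hp.run _ (by simp; omega)) _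
        (Action.eq_ofBit (hp.run h h')), isHalt_ofBit]
    · obtain ⟨a, ha⟩ := key h h'
      rw [ha]
      exact (hf a).run _ (by simp; omega)
  · intro h hh
    obtain ⟨a, ha⟩ := key h (by omega)
    rw [ha]
    exact (hf a).halt _ (by simp; omega)

theorem Timed.pure (a : α) : Timed (Pure.pure a : Protocol α) 0 :=
  ⟨fun _ h => absurd h (by simp), fun _ _ => ⟨a, rfl⟩⟩

end LocalRuns

/-! ### Synchronous executions on the whole network. -/

section NetworkRuns

variable {V : Type} [Fintype V] (G : SimpleGraph V) [DecidableRel G.Adj] {α β : Type}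

/-- Does a neighbour of `v` beep in time-step `t`, if node `u` beeps according to `B u`? -/
def hear (B : V → ℕ → Bool) (v : V) (t : ℕ) : Bool := decide (∃ u, G.Adj v u ∧ B u t = true)

/-- If node `v` runs `P v`, then all nodes halt after exactly `T` time-steps, and `out v` is the
output of `v`. -/
def NetRun (P : V → Protocol α) (T : ℕ) (out : V → α) : Prop :=
  ∃ B : V → ℕ → Bool, ∀ v, LocalRun (P v) (hear G B v) T (out v) (B v)

variable {G}

theorem hear_congr {B B' : V → ℕ → Bool} {t : ℕ} (h : ∀ u, B u t = B' u t) (v : V) :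
    hear G B v t = hear G B' v t := by
  simp [hear, h]

/-- Local consistency forces the global execution: if all histories agree with `B` up to step `t`,
then so do all actions in step `t`, and therefore what every node hears. -/
theorem NetRun.history_eq {P : V → Protocol α} {T : ℕ} {out : V → α} {B : V → ℕ → Bool}
    (h : ∀ v, LocalRun (P v) (hear G B v) T (out v) (B v)) {t : ℕ} (ht : t ≤ T) (v : V) :
    history G P t v = obs (B v) (hear G B v) t := by
  induction t generalizing v with
  | zero => rfl
  | succ t ih =>
    have ih' := fun u => ih (by omega) u
    rw [history, obs_succ]
    simp only [ih', (h _).act t (by omega), isHalt_ofBit, isListen_ofBit, isBeep_ofBit]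
    simp [hear]

theorem NetRun.outputsAt {P : V → Protocol α} {T : ℕ} {out : V → α} (h : NetRun G P T out)
    (v : V) : OutputsAt G P T v (out v) := by
  obtain ⟨B, hB⟩ := h
  constructor
  · rw [actionAt, NetRun.history_eq hB le_rfl, (hB v).halt]
  · intro s hs
    rw [actionAt, NetRun.history_eq hB hs.le, (hB v).act s hs, isHalt_ofBit]

/-- For executions of which only the duration is known, such as a campaign whose parameters disagree
between nodes. The beeps are read off from the execution itself. -/
theorem NetRun.of_timed {P : V → Protocol α} {T : ℕ} (h : ∀ v, Timed (P v) T) :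
    ∃ out, NetRun G P T out := by
  set B : V → ℕ → Bool := fun v t => (actionAt G P t v).isBeep with hB
  have hh : ∀ t ≤ T, ∀ v, history G P t v = obs (B v) (hear G B v) t := by
    intro t
    induction t with
    | zero => intro _ v; rfl
    | succ t ih =>
      intro ht v
      have ih' := ih (by omega)
      have hn : (P v (history G P t v)).isHalt = false := by
        refine (h v).run _ ?_
        rw [ih' v, length_obs]
        omega
      rw [history, if_neg (by simp [hn]), obs_succ, ih' v]
      congr 2
      rw [ih' v] at hn
      have hb : B v t = (P v (obs (B v) (hear G B v) t)).isBeep := by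
        rw [hB, ← ih' v]; rfl
      rw [hb, Action.eq_ofBit hn, isListen_ofBit, isBeep_ofBit]
      rfl
  choose out hout using fun v => (h v).halt (obs (B v) (hear G B v) T) (length_obs _ _ _)
  refine ⟨out, B, fun v => ⟨fun t ht => ?_, hout v⟩⟩
  have : B v t = (P v (obs (B v) (hear G B v) t)).isBeep := by
    rw [← hh t ht.le v]; rfl
  rw [this]
  exact Action.eq_ofBit ((h v).run _ (by simpa using ht))

/-- Since all nodes leave the first phase in the same step, the two beep patterns can be
concatenated in time without interfering. -/
theorem NetRun.bind {P : V → Protocol α} {f : V → α → Protocol β} {T₁ T₂ : ℕ} {a : V → α}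
    {b : V → β} (h₁ : NetRun G P T₁ a) (h₂ : NetRun G (fun v => f v (a v)) T₂ b) :
    NetRun G (fun v => P v >>= f v) (T₁ + T₂) b := by
  obtain ⟨B₁, h₁⟩ := h₁
  obtain ⟨B₂, h₂⟩ := h₂
  refine ⟨fun v t => if t < T₁ then B₁ v t else B₂ v (t - T₁),
    fun v => LocalRun.bind (a := a v) ?_ ?_⟩
  · refine (h₁ v).congr (fun n hn => by simp [hn]) fun n hn => hear_congr (fun u => by simp [hn]) v
  · exact (h₂ v).congr (fun n hn => by simp) fun n hn => by simp [hear]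

theorem NetRun.pure (a : V → α) : NetRun G (fun v => (Pure.pure (a v) : Protocol α)) 0 a :=
  ⟨fun _ _ => false, fun _ => LocalRun.pure _ _ _⟩

theorem NetRun.map {P : V → Protocol α} {T : ℕ} {a : V → α} (h : NetRun G P T a) (f : V → α → β) :
    NetRun G (fun v => P v >>= fun x => (Pure.pure (f v x) : Protocol β)) T fun v => f v (a v) :=
  h.bind (f := fun v x => (Pure.pure (f v x) : Protocol β)) (NetRun.pure _)

end NetworkRuns

/-! ### Leader election -/

/-- Flooding for `n` time-steps: the output tells whether `src` holds at a node within distance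
`n`. -/
def flood (n : ℕ) (src : Bool) : Protocol Bool := fun h =>
  if n ≤ h.length then .halt (src || decide (true ∈ h)) else .ofBit (src || decide (true ∈ h))

theorem timed_flood (n : ℕ) (src : Bool) : Timed (flood n src) n := by
  constructor
  · intro h hh
    simp [flood, not_le.2 hh, isHalt_ofBit]
  · intro h hh
    exact ⟨_, if_pos hh.ge⟩

section Flood

variable {V : Type} {G : SimpleGraph V}

theorem exists_adj_dist_eq (hG : G.Connected) {u v : V} {n : ℕ} (h : G.dist u v = n + 1) :
    ∃ w, G.Adj v w ∧ G.dist u w = n := by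
  obtain ⟨p, hp⟩ := hG.exists_walk_length_eq_dist v u
  rw [SimpleGraph.dist_comm, h] at hp
  cases p with
  | nil => simp at hp
  | @cons _ w _ hvw q =>
    refine ⟨w, hvw, ?_⟩
    simp at hp
    have h1 : G.dist w u ≤ q.length := SimpleGraph.dist_le q
    have h2 : G.dist u v ≤ G.dist u w + G.dist w v := hG.dist_triangle
    have h3 : G.dist w v = 1 := SimpleGraph.dist_eq_one_iff_adj.2 hvw.symm
    rw [SimpleGraph.dist_comm] at h1
    omega

theorem dist_le_succ (hG : G.Connected) (u : V) {v w : V} (h : G.Adj v w) :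
    G.dist u v ≤ G.dist u w + 1 := by
  have h2 : G.dist u v ≤ G.dist u w + G.dist w v := hG.dist_triangle
  rwa [SimpleGraph.dist_eq_one_iff_adj.2 h.symm] at h2

variable [Fintype V] [DecidableRel G.Adj]

open Classical in
theorem netRun_flood (hG : G.Connected) (n : ℕ) (src : V → Bool) :
    NetRun G (fun v => flood n (src v)) n
      fun v => decide (∃ u, src u = true ∧ G.dist u v ≤ n) := by
  set B : V → ℕ → Bool := fun v t => decide (∃ u, src u = true ∧ G.dist u v ≤ t) with hB
  have key : ∀ v t, (src v || decide (true ∈ obs (B v) (hear G B v) t)) = B v t := by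
    intro v t
    rw [Bool.eq_iff_iff]
    simp only [Bool.or_eq_true, decide_eq_true_eq, true_mem_obs, hear, hB, decide_eq_false_iff_not]
    constructor
    · rintro (h | ⟨m, hm, -, w, hvw, u, hu, hd⟩)
      · exact ⟨v, h, by simp⟩
      · exact ⟨u, hu, (dist_le_succ hG u hvw).trans (by omega)⟩
    · rintro ⟨u, hu, hd⟩
      by_cases hv : src v = true
      · exact Or.inl hv
      right
      -- The least such `m` is the distance to a nearest source. A neighbour one step closer beeps
      -- in the step just before, in which `v` is still silent and therefore listening.
      have hex : ∃ m, ∃ u, src u = true ∧ G.dist u v ≤ m := ⟨_, u, hu, hd⟩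
      obtain ⟨u', hu', hd'⟩ := Nat.find_spec hex
      have hle : Nat.find hex ≤ t := Nat.find_min' hex ⟨u, hu, hd⟩
      have heq : G.dist u' v = Nat.find hex :=
        le_antisymm hd' (Nat.find_min' hex ⟨u', hu', le_rfl⟩)
      cases hf : Nat.find hex with
      | zero =>
        rw [hf] at heq
        rw [hG.dist_eq_zero_iff] at heq
        exact absurd (heq ▸ hu') hv
      | succ m =>
        rw [hf] at heq
        obtain ⟨w, hvw, hw⟩ := exists_adj_dist_eq hG heq
        exact ⟨m, by omega, Nat.find_min hex (by omega), w, hvw, u', hu', hw.le⟩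
  refine ⟨B, fun v => ⟨fun t ht => ?_, ?_⟩⟩
  · simp only [flood, length_obs, not_le.2 ht, if_false]
    rw [key]
  · simp only [flood, length_obs, le_refl, if_true]
    rw [key]

end Flood

/-- Broadcast of size classes: flooding for `2 ^ (j - b)` time-steps from the nodes of class at
least `b`, for all `b < n`; the output is the largest `b` for which a beep was heard. -/
def levels (j c : ℕ) : ℕ → Protocol ℕ
  | 0 => pure 0
  | b + 1 => do
    let m ← levels j c b
    let r ← flood (2 ^ (j - b)) (decide (b ≤ c))
    pure (if r then b else m)

/-- Bitwise determination of the largest number held by a remaining candidate, each bit by flooding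
for `n` time-steps; `w` bits remain, `s.1` tells whether this node is a candidate, and `s.2` is the
number represented by the bits already known. -/
def campaign (n ident : ℕ) : ℕ → Bool × ℕ → Protocol ℕ
  | 0, s => pure s.2
  | w + 1, s => do
    let r ← flood n (s.1 && ident.testBit w)
    campaign n ident w (s.1 && ident.testBit w == r, 2 * s.2 + r.toNat)

/-- Does some of the lowest `w` bits of `x` vary in the closed neighbourhood of this node? -/
def differs (x : ℕ) : ℕ → Protocol Bool
  | 0 => pure false
  | w + 1 => do
    let a ← flood 1 (x.testBit w)
    let b ← flood 1 (!x.testBit w)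
    let d ← differs x w
    pure (d || a && b)

/-- An attempt of leader election with time budget `X = 2 ^ j`.  After the computation of a proposal
`x` it is checked that neighbours have the same proposal, that the node proposed is within distance
`X`, and that `x` is not exceeded; each violation is announced within distance `3 * X + 1`. -/
def attempt (j ident : ℕ) : Protocol (Option ℕ) := do
  let b ← levels j (Nat.clog 2 ident.size) (j + 1)
  let y ← campaign (2 ^ (j - b)) ident (2 ^ b) (true, 0)
  let x := y % 2 ^ 2 ^ j
  let o ← flood (2 ^ j) (x == ident)
  let d ← differs x (2 ^ j)
  let r ← flood (3 * 2 ^ j + 1) (d || !o || decide (x < ident))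
  pure (if r then none else some x)

/-- At most `n` attempts of leader election, with doubling budgets. -/
def electLoop (ident : ℕ) : ℕ → ℕ → Protocol ℕ
  | 0, _ => fun _ => .listen
  | n + 1, j => do
    let r ← attempt j ident
    match r with
    | some x => pure x
    | none => electLoop ident n (j + 1)

/-- Leader election: attempts with doubling budgets until one succeeds. -/
def elect (ident : ℕ) : Protocol ℕ := fun h => electLoop ident (h.length + 1) 0 h

/-- The duration of `levels`. -/
def levelsTime (j n : ℕ) : ℕ := ∑ b ∈ Finset.range n, 2 ^ (j - b)

theorem levelsTime_succ_self (j : ℕ) : levelsTime j (j + 1) + 1 = 2 * 2 ^ j := by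
  have : levelsTime j (j + 1) = ∑ b ∈ Finset.range (j + 1), 2 ^ b := by
    rw [levelsTime, ← Finset.sum_range_reflect]
    refine Finset.sum_congr rfl fun b hb => ?_
    rw [Finset.mem_range] at hb
    congr 1
    omega
  rw [this, Nat.geomSum_eq le_rfl]
  have := Nat.one_le_two_pow (n := j + 1)
  rw [pow_succ] at *
  omega

theorem timed_campaign (n ident w : ℕ) (s : Bool × ℕ) : Timed (campaign n ident w s) (n * w) := by
  induction w generalizing s with
  | zero => exact Timed.pure _
  | succ w ih =>
    rw [Nat.mul_succ, Nat.add_comm (n * w)]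
    exact (timed_flood _ _).bind fun _ => ih _

section ElectionRuns

variable {V : Type} [Fintype V] {G : SimpleGraph V} [DecidableRel G.Adj]

/-- If `D * 2 ^ m ≤ 2 ^ j`, then every class `b ≤ m` floods for `2 ^ (j - b) ≥ D` steps and reaches
everybody, while no node starts a flooding for a class above `m`. The unconditional bound on the
output serves to fix the duration of the following campaign. -/
theorem netRun_levels (hG : G.Connected) (j : ℕ) (c : V → ℕ) (n : ℕ) :
    ∃ out : V → ℕ, NetRun G (fun v => levels j (c v) n) (levelsTime j n) out ∧
      (∀ v, out v ≤ n - 1) ∧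
      ∀ m D, (∀ v, c v ≤ m) → (∃ v, c v = m) → (∀ u v, G.dist u v ≤ D) → D * 2 ^ m ≤ 2 ^ j →
        ∀ v, out v = min (n - 1) m := by
  classical
  induction n with
  | zero => exact ⟨fun _ => 0, NetRun.pure _, by simp, by simp⟩
  | succ b ih =>
    obtain ⟨out, hrun, hle, hout⟩ := ih
    have hstep := hrun.bind (f := fun v m => do
        let r ← flood (2 ^ (j - b)) (decide (b ≤ c v))
        pure (if r then b else m)) ((netRun_flood hG (2 ^ (j - b)) fun v => decide (b ≤ c v)).map
        fun v r => if r then b else out v)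
    rw [levelsTime, ← Finset.sum_range_succ] at hstep
    refine ⟨_, hstep, ?_, ?_⟩
    · intro v
      split
      · simp
      · have := hle v
        omega
    · intro m D hc hm hD hj v
      simp only [decide_eq_true_eq]
      have hv := hout m D hc hm hD hj v
      by_cases hb : b ≤ m
      · rw [if_pos]
        · simp [hb]
        · obtain ⟨u, hu⟩ := hm
          refine ⟨u, hu ▸ hb, (hD u v).trans ?_⟩
          refine Nat.le_of_mul_le_mul_right (hj.trans ?_) (Nat.two_pow_pos m)
          rw [← pow_add]
          exact Nat.pow_le_pow_right two_pos (by omega)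
      · rw [if_neg, hv]
        · omega
        · rintro ⟨u, hu, -⟩
          exact hb (hu.trans (hc u))

/-- Candidates are the nodes that agree with `m` above the current bit. As none exceeds `m` and one
equals it, some candidate has the bit set exactly if `m` has. -/
theorem netRun_campaign (hG : G.Connected) (n : ℕ) (ident : V → ℕ) (m : ℕ)
    (hm : ∀ v, ident v ≤ m) (hex : ∃ v, ident v = m) (hn : ∀ u v, G.dist u v ≤ n) (w : ℕ) :
    NetRun G (fun v => campaign n (ident v) w (decide (ident v / 2 ^ w = m / 2 ^ w), m / 2 ^ w))
      (n * w) fun _ => m := by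
  classical
  induction w with
  | zero => simpa [campaign] using NetRun.pure (G := G) fun _ : V => m
  | succ w ih =>
    have hdiv : ∀ a, a / 2 ^ w = 2 * (a / 2 ^ (w + 1)) + (a.testBit w).toNat := by
      intro a
      rw [Nat.testBit_eq_decide_div_mod_eq, pow_succ, ← Nat.div_div_eq_div_mul]
      rcases Nat.mod_two_eq_zero_or_one (a / 2 ^ w) with h | h <;> simp [h] <;> omega
    have hr : ∀ v, decide (∃ u, (decide (ident u / 2 ^ (w + 1) = m / 2 ^ (w + 1)) &&
        (ident u).testBit w) = true ∧ G.dist u v ≤ n) = m.testBit w := by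
      intro v
      rw [Bool.eq_iff_iff]
      simp only [decide_eq_true_eq, Bool.and_eq_true]
      constructor
      · rintro ⟨u, ⟨hu, hb⟩, -⟩
        by_contra hmb
        have h1 := hdiv (ident u)
        have h2 := hdiv m
        have h3 := Nat.div_le_div_right (c := 2 ^ w) (hm u)
        simp only [Bool.not_eq_true] at hmb
        simp only [hb, hmb, Bool.toNat_true, Bool.toNat_false] at h1 h2
        omega
      · intro hmb
        obtain ⟨u, hu⟩ := hex
        exact ⟨u, by simp [hu, hmb], hn u v⟩
    rw [Nat.mul_succ, Nat.add_comm (n * w)]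
    refine (netRun_flood hG n _).bind ?_
    simp only [hr]
    convert ih using 3 with v
    ext1
    · rw [Bool.eq_iff_iff]
      simp only [Bool.and_eq_true, decide_eq_true_eq, beq_iff_eq]
      have h1 := hdiv (ident v)
      have h2 := hdiv m
      constructor
      · rintro ⟨ha, hb⟩
        rw [h1, h2, ha, hb]
      · intro h
        cases hx : (ident v).testBit w <;> cases hy : m.testBit w <;>
          simp only [hx, hy, Bool.toNat_true, Bool.toNat_false] at h1 h2 <;> simp <;> omega
    · exact (hdiv m).symm

theorem netRun_differs (hG : G.Connected) (x : V → ℕ) (w : ℕ) :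
    ∃ out : V → Bool, NetRun G (fun v => differs (x v) w) (2 * w) out ∧
      (∀ v, out v = false → ∀ u, G.Adj v u → ∀ i < w, (x u).testBit i = (x v).testBit i) ∧
      ((∀ u v, x u = x v) → ∀ v, out v = false) := by
  classical
  induction w with
  | zero => exact ⟨fun _ => false, NetRun.pure _, by simp, by simp⟩
  | succ w ih =>
    obtain ⟨out, hrun, h1, h2⟩ := ih
    have := (netRun_flood hG 1 fun v => (x v).testBit w).bind
      (f := fun v a => do
        let b ← flood 1 (!(x v).testBit w)
        let d ← differs (x v) w
        pure (d || a && b))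
      ((netRun_flood hG 1 fun v => !(x v).testBit w).bind
        (f := fun v b => do
          let d ← differs (x v) w
          pure (d || _ && b)) (hrun.map fun v d => d || _ && _))
    rw [show 1 + (1 + 2 * w) = 2 * (w + 1) by ring] at this
    refine ⟨_, this, ?_, ?_⟩
    · intro v hv u huv i hi
      simp only [Bool.or_eq_false_iff, Bool.and_eq_false_iff, decide_eq_false_iff_not] at hv
      rcases Nat.lt_succ_iff_lt_or_eq.1 hi with hi | rfl
      · exact h1 v hv.1 u huv i hi
      have hvu : G.dist u v ≤ 1 := (SimpleGraph.dist_eq_one_iff_adj.2 huv.symm).le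
      rcases hv.2 with h | h
      · have hu : (x u).testBit i = false := by
          by_contra hne
          exact h ⟨u, by simpa using hne, hvu⟩
        have hv' : (x v).testBit i = false := by
          by_contra hne
          exact h ⟨v, by simpa using hne, by simp⟩
        rw [hu, hv']
      · have hu : (x u).testBit i = true := by
          by_contra hne
          exact h ⟨u, by simpa using hne, hvu⟩
        have hv' : (x v).testBit i = true := by
          by_contra hne
          exact h ⟨v, by simpa using hne, by simp⟩
        rw [hu, hv']
    · intro heq v
      simp only [Bool.or_eq_false_iff, Bool.and_eq_false_iff, decide_eq_false_iff_not]
      refine ⟨h2 heq v, ?_⟩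
      cases hb : (x v).testBit w
      · left
        rintro ⟨u, hu, -⟩
        rw [heq u v, hb] at hu
        exact absurd hu (by simp)
      · right
        rintro ⟨u, hu, -⟩
        rw [heq u v, hb] at hu
        exact absurd hu (by simp)

end ElectionRuns

section ElectionRuns

variable {V : Type} {G : SimpleGraph V}

theorem exists_dist_eq_of_le (hG : G.Connected) {u v : V} {n : ℕ} (h : n ≤ G.dist u v) :
    ∃ w, G.dist u w = n := by
  obtain ⟨k, hk⟩ := Nat.exists_eq_add_of_le h
  clear h
  induction k generalizing v with
  | zero => exact ⟨v, hk⟩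
  | succ k ih =>
    obtain ⟨w, -, hw⟩ := exists_adj_dist_eq hG (n := n + k) hk
    exact ih hw

variable [Fintype V]

/-- A proposal for the leader that passes all checks near one node is the highest identifier, and it
is shared by all nodes, which are all near that node. -/
theorem proposal_eq_of_checks (hG : G.Connected) {ident : V → ℕ} (hinj : Function.Injective ident)
    (x : V → ℕ) (X : ℕ) (v : V)
    (hadj : ∀ u w, G.dist v u ≤ 3 * X + 1 → G.Adj u w → x w = x u)
    (hown : ∀ u, G.dist v u ≤ 3 * X + 1 → ∃ w, x w = ident w ∧ G.dist w u ≤ X)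
    (hmax : ∀ u, G.dist v u ≤ 3 * X + 1 → ident u ≤ x u) (u : V) :
    x u = Finset.univ.sup ident ∧ G.dist v u ≤ 3 * X + 1 := by
  have hball : ∀ n ≤ 3 * X + 1, ∀ u, G.dist v u = n → x u = x v := by
    intro n
    induction n with
    | zero =>
      intro _ u hu
      rw [(hG.dist_eq_zero_iff).1 hu]
    | succ n ih =>
      intro hn u hu
      obtain ⟨w, huw, hw⟩ := exists_adj_dist_eq hG hu
      rw [← ih (by omega) w hw, hadj w u (by omega) huw.symm]
  have hball' : ∀ u, G.dist v u ≤ 3 * X + 1 → x u = x v := fun u hu => hball _ hu u rfl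
  obtain ⟨w, hw, hwd⟩ := hown v (by simp)
  rw [SimpleGraph.dist_comm] at hwd
  have hxw := hball' w (by omega)
  -- Otherwise some `z` has distance exactly `X + 1` from the owner `w`. It lies within `2 * X + 1`
  -- of `v`, so its own nearby owner `w'` lies within `3 * X + 1` and shares the proposal.
  -- Injectivity gives `w' = w`, although `w'` is within `X` of `z`.
  have hall : ∀ u, G.dist w u ≤ X := by
    by_contra! hne
    obtain ⟨y, hy⟩ := hne
    obtain ⟨z, hz⟩ := exists_dist_eq_of_le hG (Nat.succ_le_of_lt hy)
    have h1 : G.dist v z ≤ G.dist v w + G.dist w z := hG.dist_triangle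
    obtain ⟨w', hw', hwd'⟩ := hown z (by omega)
    have h2 : G.dist v w' ≤ G.dist v z + G.dist z w' := hG.dist_triangle
    have hxw' := hball' w' (by rw [G.dist_comm (u := z)] at h2; omega)
    have : w' = w := hinj (by rw [← hw', ← hw, hxw, hxw'])
    subst this
    omega
  have hin : ∀ u, G.dist v u ≤ 3 * X + 1 := fun u => by
    have h1 : G.dist v u ≤ G.dist v w + G.dist w u := hG.dist_triangle
    have := hall u
    omega
  refine ⟨?_, hin u⟩
  rw [hball' u (hin u)]
  refine le_antisymm ?_ (Finset.sup_le fun u _ => (hmax u (hin u)).trans (hball' u (hin u)).le)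
  rw [← hxw, hw]
  exact Finset.le_sup (f := ident) (Finset.mem_univ w)

theorem lt_two_pow_two_pow_clog_size (m : ℕ) : m < 2 ^ 2 ^ Nat.clog 2 m.size :=
  (Nat.lt_size_self m).trans_le
    (Nat.pow_le_pow_right two_pos (Nat.le_pow_clog one_lt_two _))

theorem exists_ident_eq_sup [Nonempty V] (ident : V → ℕ) :
    ∃ v, ident v = Finset.univ.sup ident := by
  obtain ⟨v, -, hv⟩ := Finset.exists_mem_eq_sup Finset.univ Finset.univ_nonempty ident
  exact ⟨v, hv.symm⟩

theorem dist_le_diam_of_connected (hG : G.Connected) (u v : V) : G.dist u v ≤ G.diam := by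
  have : Nonempty V := ⟨u⟩
  exact SimpleGraph.dist_le_diam (SimpleGraph.connected_iff_ediam_ne_top.1 hG)

variable [DecidableRel G.Adj]

/-- Flooding time times number of bits is `2 ^ j` for every `b v ≤ j`, so all nodes finish together
even if their parameters disagree; a meaningful result is needed only under a sufficient budget. -/
theorem netRun_proposal [Nonempty V] (hG : G.Connected) (ident : V → ℕ) (j : ℕ) (b : V → ℕ)
    (hb : ∀ v, b v ≤ j) (m : ℕ) (hm : m = Finset.univ.sup ident) :
    ∃ y : V → ℕ,
      NetRun G (fun v => campaign (2 ^ (j - b v)) (ident v) (2 ^ b v) (true, 0)) (2 ^ j) y ∧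
      (G.diam * 2 ^ Nat.clog 2 m.size ≤ 2 ^ j → (∀ v, b v = Nat.clog 2 m.size) →
        ∀ v, y v = m) := by
  have htime : ∀ v, 2 ^ (j - b v) * 2 ^ b v = 2 ^ j := fun v => by
    rw [← pow_add]
    congr 1
    have := hb v
    omega
  have hle : ∀ v, ident v ≤ m := fun v => hm ▸ Finset.le_sup (f := ident) (Finset.mem_univ v)
  by_cases h : G.diam * 2 ^ Nat.clog 2 m.size ≤ 2 ^ j ∧ ∀ v, b v = Nat.clog 2 m.size
  · refine ⟨fun _ => m, ?_, fun _ _ _ => rfl⟩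
    obtain ⟨hj, hbv⟩ := h
    obtain ⟨v₀⟩ := ‹Nonempty V›
    have hj' := hbv v₀ ▸ hb v₀
    have := netRun_campaign hG (2 ^ (j - Nat.clog 2 m.size)) ident m hle
      (hm ▸ exists_ident_eq_sup ident)
      (fun u v => (dist_le_diam_of_connected hG u v).trans (by
        refine Nat.le_of_mul_le_mul_right (hj.trans ?_) (Nat.two_pow_pos (Nat.clog 2 m.size))
        rw [← pow_add]
        exact Nat.pow_le_pow_right two_pos (by omega))) (2 ^ Nat.clog 2 m.size)
    have hlt := lt_two_pow_two_pow_clog_size m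
    rw [← htime v₀, hbv v₀]
    convert this using 3 with v
    · rw [hbv v]
    · rw [hbv v]
    · rw [Nat.div_eq_of_lt hlt, Nat.div_eq_of_lt ((hle v).trans_lt hlt)]
      simp
  · obtain ⟨y, hy⟩ := NetRun.of_timed (G := G) (T := 2 ^ j)
      (P := fun v => campaign (2 ^ (j - b v)) (ident v) (2 ^ b v) (true, 0))
      fun v => htime v ▸ timed_campaign _ _ _ _
    exact ⟨y, hy, fun h1 h2 => absurd ⟨h1, h2⟩ h⟩

/-- Unanimity comes from `proposal_eq_of_checks`, applied at any node that accepts. The condition `2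
^ Nat.clog 2 m.size ≤ 2 ^ j` ensures that truncating proposals to `2 ^ j` bits leaves `m` intact. -/
theorem netRun_attempt [Nonempty V] (hG : G.Connected) {ident : V → ℕ}
    (hinj : Function.Injective ident) (j m : ℕ) (hm : m = Finset.univ.sup ident) :
    ∃ out : Option ℕ, NetRun G (fun v => attempt j (ident v)) (9 * 2 ^ j) (fun _ => out) ∧
      (out = none ∨ out = some m) ∧
      (2 ^ Nat.clog 2 m.size ≤ 2 ^ j → G.diam * 2 ^ Nat.clog 2 m.size ≤ 2 ^ j →
        out = some m) := by
  classical
  have hle : ∀ v, ident v ≤ m := fun v => hm ▸ Finset.le_sup (f := ident) (Finset.mem_univ v)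
  obtain ⟨v₀, hv₀⟩ := exists_ident_eq_sup ident
  rw [← hm] at hv₀
  obtain ⟨b, hb, hbj, hb'⟩ := netRun_levels hG j (fun v => Nat.clog 2 (ident v).size) (j + 1)
  obtain ⟨y, hy, hy'⟩ := netRun_proposal hG ident j b (fun v => by simpa using hbj v) m hm
  set x : V → ℕ := fun v => y v % 2 ^ 2 ^ j with hx
  have hxlt : ∀ v, x v < 2 ^ 2 ^ j := fun v => Nat.mod_lt _ (Nat.two_pow_pos _)
  have ho := netRun_flood hG (2 ^ j) fun v => x v == ident v
  obtain ⟨d, hd, hd₁, hd₂⟩ := netRun_differs hG x (2 ^ j)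
  set o : V → Bool := fun v => decide (∃ u, (x u == ident u) = true ∧ G.dist u v ≤ 2 ^ j) with hodef
  set bad : V → Bool := fun v => d v || !o v || decide (x v < ident v) with hbad
  have hr := netRun_flood hG (3 * 2 ^ j + 1) bad
  set r : V → Bool := fun v => decide (∃ u, bad u = true ∧ G.dist u v ≤ 3 * 2 ^ j + 1) with hrdef
  have hrun := hb.bind (f := fun v b => do
    let y ← campaign (2 ^ (j - b)) (ident v) (2 ^ b) (true, 0)
    let x := y % 2 ^ 2 ^ j
    let o ← flood (2 ^ j) (x == ident v)
    let d ← differs x (2 ^ j)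
    let r ← flood (3 * 2 ^ j + 1) (d || !o || decide (x < ident v))
    pure (if r then none else some x))
    (hy.bind (f := fun v y => do
      let x := y % 2 ^ 2 ^ j
      let o ← flood (2 ^ j) (x == ident v)
      let d ← differs x (2 ^ j)
      let r ← flood (3 * 2 ^ j + 1) (d || !o || decide (x < ident v))
      pure (if r then none else some x))
    (ho.bind (f := fun v o => do
      let d ← differs (x v) (2 ^ j)
      let r ← flood (3 * 2 ^ j + 1) (d || !o || decide (x v < ident v))
      pure (if r then none else some (x v)))
    (hd.bind (f := fun v d => do
      let r ← flood (3 * 2 ^ j + 1) (d || !o v || decide (x v < ident v))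
      pure (if r then none else some (x v)))
    (hr.map fun v r => if r then none else some (x v)))))
  -- The `1` missing from the geometric sum for `levels` is the extra step of the final flooding.
  have htime : levelsTime j (j + 1) + (2 ^ j + (2 ^ j + (2 * 2 ^ j + (3 * 2 ^ j + 1)))) =
      9 * 2 ^ j := by
    have := levelsTime_succ_self j
    omega
  rw [htime] at hrun
  change NetRun G (fun v => attempt j (ident v)) _ fun v => if r v then none else some (x v) at hrun
  have hok : ∀ v, r v = false → ∀ u, x u = m ∧ r u = false := by
    intro v hv u
    have hgood : ∀ u, G.dist v u ≤ 3 * 2 ^ j + 1 → bad u = false := by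
      intro u hu
      by_contra hne
      simp only [hrdef, decide_eq_false_iff_not] at hv
      exact hv ⟨u, by simpa using hne, by rwa [SimpleGraph.dist_comm]⟩
    have hgood' := hgood
    simp only [hbad, Bool.or_eq_false_iff, decide_eq_false_iff_not, not_lt,
      Bool.not_eq_eq_eq_not, Bool.not_false] at hgood
    have hchecks : ∀ u, x u = Finset.univ.sup ident ∧ G.dist v u ≤ 3 * 2 ^ j + 1 := by
      refine proposal_eq_of_checks hG hinj x (2 ^ j) v (fun u w hu huw => ?_)
        (fun u hu => ?_) (fun u hu => (hgood u hu).2)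
      -- Only the lowest `2 ^ j` bits are compared by `differs`; the others vanish because of the
      -- truncation.
      · refine Nat.eq_of_testBit_eq fun i => ?_
        rcases lt_or_ge i (2 ^ j) with hi | hi
        · exact hd₁ u (hgood u hu).1.1 w huw i hi
        · rw [Nat.testBit_lt_two_pow ((hxlt u).trans_le (Nat.pow_le_pow_right two_pos hi)),
            Nat.testBit_lt_two_pow ((hxlt w).trans_le (Nat.pow_le_pow_right two_pos hi))]
      · simpa [hodef] using (hgood u hu).1.2
    refine ⟨hm ▸ (hchecks u).1, ?_⟩
    simp only [hrdef, decide_eq_false_iff_not]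
    rintro ⟨w, hw, -⟩
    rw [hgood' w (hchecks w).2] at hw
    exact absurd hw (by simp)
  have hok' : (∀ v, x v = m) → G.diam ≤ 2 ^ j → ∀ v, r v = false := by
    intro h hD v
    simp only [hrdef, decide_eq_false_iff_not]
    rintro ⟨u, hu, -⟩
    simp only [hbad, Bool.or_eq_true, Bool.not_eq_eq_eq_not, Bool.not_true, hodef,
      decide_eq_false_iff_not, decide_eq_true_eq] at hu
    rcases hu with (hu | hu) | hu
    · rw [hd₂ (fun a b => by rw [h, h])] at hu
      exact absurd hu (by simp)
    · exact hu ⟨v₀, by simp [h, hv₀], (dist_le_diam_of_connected hG _ _).trans hD⟩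
    · rw [h] at hu
      exact absurd (hle u) (by omega)
  by_cases hall : ∀ v, r v = true
  · refine ⟨none, ?_, Or.inl rfl, fun hc hj => ?_⟩
    · simpa only [hall, if_true] using hrun
    · have hcj : Nat.clog 2 m.size ≤ j := (Nat.pow_le_pow_iff_right one_lt_two).1 hc
      have hxm : ∀ v, x v = m := fun v => by
        have : y v = m := hy' hj (fun v => by
          rw [hb' (Nat.clog 2 m.size) G.diam
            (fun v => Nat.clog_mono_right 2 (Nat.size_le_size (hle v))) ⟨v₀, by rw [hv₀]⟩
            (dist_le_diam_of_connected hG) hj v]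
          omega) v
        simp only [hx, this]
        exact Nat.mod_eq_of_lt ((lt_two_pow_two_pow_clog_size m).trans_le
          (Nat.pow_le_pow_right two_pos hc))
      have := hok' hxm ((Nat.le_mul_of_pos_right _ (Nat.two_pow_pos _)).trans hj) v₀
      rw [hall] at this
      exact absurd this (by simp)
  · push Not at hall
    obtain ⟨v, hv⟩ := hall
    have hxm := hok v (by simpa using hv)
    refine ⟨some m, ?_, Or.inr rfl, fun _ _ => rfl⟩
    simpa only [fun u => (hxm u).1, fun u => (hxm u).2, Bool.false_eq_true, if_false] using hrun

end ElectionRuns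

theorem isHalt_bind_nil {α β : Type} {p : Protocol α} (f : α → Protocol β)
    (h : (p []).isHalt = false) : ((p >>= f) []).isHalt = false := by
  rw [andThen_of_running p f [] (by simp) _ (Action.eq_ofBit h), isHalt_ofBit]

theorem isHalt_levels_nil (j c n : ℕ) : (levels j c (n + 1) []).isHalt = false := by
  induction n with
  | zero =>
    have h := andThen_of_halted (pure 0) (fun m => do
      let r ← flood (2 ^ (j - 0)) (decide (0 ≤ c))
      pure (if r then 0 else m)) [] [] (by simp) 0 rfl
    rw [levels, levels]
    refine (congrArg _ h).trans ?_
    exact isHalt_bind_nil _ ((timed_flood (2 ^ (j - 0)) _).run [] (Nat.two_pow_pos _))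
  | succ n ih => exact isHalt_bind_nil _ ih

/-- An attempt lasts at least one step, so fuel exceeding the history length is never used up. Hence
`elect`, whose fuel grows with the history, behaves like the loop with one fixed, large fuel. -/
theorem electLoop_congr (ident : ℕ) (h : List Bool) (n n' j : ℕ) (hn : h.length < n)
    (hn' : h.length < n') : electLoop ident n j h = electLoop ident n' j h := by
  induction n generalizing n' j h with
  | zero => omega
  | succ n ih =>
    cases n' with
    | zero => omega
    | succ n' =>
      refine andThen_congr_of_length_lt _ _ _ _ (isHalt_bind_nil _ (isHalt_levels_nil _ _ _))
        fun a h' hh => ?_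
      cases a with
      | some x => rfl
      | none => exact ih h' n' (j + 1) (by omega) (by omega)

section ElectionRuns

variable {V : Type} [Fintype V] {G : SimpleGraph V} [DecidableRel G.Adj]

/-- Downward induction from budget `2 ^ J`, which certainly suffices; a smaller budget may also
succeed, but then with the same output. The bound is the geometric sum of `9 * 2 ^ i` over `J - k ≤
i ≤ J`. -/
theorem netRun_electLoop [Nonempty V] (hG : G.Connected) {ident : V → ℕ}
    (hinj : Function.Injective ident) (m J : ℕ) (hm : m = Finset.univ.sup ident)
    (hJ : 2 ^ Nat.clog 2 m.size ≤ 2 ^ J) (hJ' : G.diam * 2 ^ Nat.clog 2 m.size ≤ 2 ^ J) (k : ℕ)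
    (hk : k ≤ J) :
    ∃ T ≤ 9 * (2 * 2 ^ J - 2 ^ (J - k)), ∀ n > k,
      NetRun G (fun v => electLoop (ident v) n (J - k)) T fun _ => m := by
  induction k with
  | zero =>
    obtain ⟨out, hrun, -, hout⟩ := netRun_attempt hG hinj J m hm
    rw [hout hJ hJ'] at hrun
    refine ⟨9 * 2 ^ J, by simp; omega, fun n hn => ?_⟩
    obtain ⟨n, rfl⟩ := Nat.exists_eq_succ_of_ne_zero hn.ne'
    exact hrun.bind (T₂ := 0) (f := fun v r => match r with
      | some x => pure x
      | none => electLoop (ident v) n (J + 1)) (NetRun.pure _)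
  | succ k ih =>
    obtain ⟨T, hT, hrunT⟩ := ih (by omega)
    obtain ⟨out, hrun, hor, -⟩ := netRun_attempt hG hinj (J - (k + 1)) m hm
    have hpow : 2 ^ (J - k) = 2 * 2 ^ (J - (k + 1)) := by
      rw [← pow_succ']
      congr 1
      omega
    have hpow' : 2 ^ (J - k) ≤ 2 ^ J := Nat.pow_le_pow_right two_pos (by omega)
    rcases hor with rfl | rfl
    · refine ⟨9 * 2 ^ (J - (k + 1)) + T, by omega, fun n hn => ?_⟩
      obtain ⟨n, rfl⟩ := Nat.exists_eq_succ_of_ne_zero (Nat.ne_zero_of_lt hn)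
      have := hrunT n (by omega)
      rw [show J - k = J - (k + 1) + 1 by omega] at this
      exact hrun.bind (f := fun v r => match r with
        | some x => pure x
        | none => electLoop (ident v) n (J - (k + 1) + 1)) this
    · refine ⟨9 * 2 ^ (J - (k + 1)), by omega, fun n hn => ?_⟩
      obtain ⟨n, rfl⟩ := Nat.exists_eq_succ_of_ne_zero (Nat.ne_zero_of_lt hn)
      exact hrun.bind (T₂ := 0) (f := fun v r => match r with
        | some x => pure x
        | none => electLoop (ident v) n (J - (k + 1) + 1)) (NetRun.pure _)

theorem netRun_elect [Nonempty V] (hG : G.Connected) {ident : V → ℕ}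
    (hinj : Function.Injective ident) (m J : ℕ) (hm : m = Finset.univ.sup ident)
    (hJ : 2 ^ Nat.clog 2 m.size ≤ 2 ^ J) (hJ' : G.diam * 2 ^ Nat.clog 2 m.size ≤ 2 ^ J) :
    ∃ T ≤ 18 * 2 ^ J, NetRun G (fun v => elect (ident v)) T fun _ => m := by
  obtain ⟨T, hT, hrun⟩ := netRun_electLoop hG hinj m J hm hJ hJ' J le_rfl
  rw [Nat.sub_self] at hrun
  obtain ⟨B, hB⟩ := hrun (J + T + 1) (by omega)
  have heq : ∀ v, ∀ t ≤ T, elect (ident v) (obs (B v) (hear G B v) t) =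
      electLoop (ident v) (J + T + 1) 0 (obs (B v) (hear G B v) t) := fun v t ht =>
    electLoop_congr _ _ _ _ _ (by simp) (by simp; omega)
  refine ⟨T, by rw [Nat.sub_self] at hT; omega, B, fun v => ⟨fun t ht => ?_, ?_⟩⟩
  · exact (heq v t ht.le).trans ((hB v).act t ht)
  · exact (heq v T le_rfl).trans (hB v).halt

theorem one_le_logb_of_injective {W : Type} [Nontrivial W] {ident : W → ℕ}
    (hinj : Function.Injective ident) {L : ℕ} (hL : ∀ v, ident v < L) : 1 ≤ Real.logb 2 L := by
  obtain ⟨u, v, huv⟩ := exists_pair_ne W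
  have h2 : 2 ≤ L := by
    have h1 := hL u
    have h2 := hL v
    have h3 : ident u ≠ ident v := fun h => huv (hinj h)
    omega
  rw [Real.le_logb_iff_rpow_le (by norm_num) (by positivity)]
  simpa using (show (2 : ℝ) ≤ L by exact_mod_cast h2)

theorem size_le_logb_add_one {m L : ℕ} (hL : 1 ≤ L) (h : m < L) :
    (m.size : ℝ) ≤ Real.logb 2 L + 1 := by
  rcases Nat.eq_zero_or_pos m.size with h0 | h0
  · rw [h0]
    have := Real.logb_nonneg (b := 2) (by norm_num) (show (1 : ℝ) ≤ L by exact_mod_cast hL)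
    push_cast
    linarith
  obtain ⟨s, hs⟩ := Nat.exists_eq_succ_of_ne_zero h0.ne'
  have h1 : 2 ^ s ≤ m := Nat.lt_size.1 (by omega)
  have h2 : (s : ℝ) ≤ Real.logb 2 L := by
    rw [Real.le_logb_iff_rpow_le (by norm_num) (by positivity), Real.rpow_natCast]
    exact_mod_cast h1.trans h.le
  rw [hs]
  push_cast
  linarith

theorem one_le_diam {W : Type} [Fintype W] [Nontrivial W] {H : SimpleGraph W}
    (hG : H.Connected) : 1 ≤ H.diam := by
  obtain ⟨u, v, huv⟩ := exists_pair_ne W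
  exact (hG.pos_dist_of_ne huv).trans_le (dist_le_diam_of_connected hG u v)

/-- The leader election procedure is correct and takes `O(D log L)` time-steps. -/
theorem exists_netRun_elect [Nontrivial V] (hG : G.Connected) {ident : V → ℕ}
    (hinj : Function.Injective ident) {L : ℕ} (hL : ∀ v, ident v < L) :
    ∃ T : ℕ, (T : ℝ) ≤ 144 * (G.diam * Real.logb 2 L) ∧
      NetRun G (fun v => elect (ident v)) T fun _ => Finset.univ.sup ident := by
  set m := Finset.univ.sup ident with hm
  have hD := one_le_diam hG
  set c := Nat.clog 2 m.size with hc
  set J := Nat.clog 2 (G.diam * 2 ^ c) with hJ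
  have h1 : G.diam * 2 ^ c ≤ 2 ^ J := Nat.le_pow_clog one_lt_two _
  obtain ⟨T, hT, hrun⟩ := netRun_elect hG hinj m J hm
    ((Nat.le_mul_of_pos_left _ hD).trans h1) h1
  refine ⟨T, ?_, hrun⟩
  -- Rounding up to a power of two happens twice, for `m.size` and for the budget. With `m.size ≤ 2
  -- * log₂ L` this gives `18 * 4 * 2 = 144`.
  have hclog : ∀ a, 1 ≤ a → 2 ^ Nat.clog 2 a ≤ 2 * a := by
    intro a ha
    rcases Nat.lt_or_ge 1 a with h | h
    · have := Nat.pow_pred_clog_lt_self (b := 2) one_lt_two h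
      have hpos := Nat.clog_pos one_lt_two h
      obtain ⟨k, hk⟩ := Nat.exists_eq_succ_of_ne_zero hpos.ne'
      rw [hk] at this ⊢
      rw [pow_succ]
      simp at this
      omega
    · have : a = 1 := le_antisymm h ha
      simp [this]
  obtain ⟨u, v, huv⟩ := exists_pair_ne V
  have hmpos : 1 ≤ m := by
    by_contra! h0
    have h1 : ident u ≤ m := Finset.le_sup (f := ident) (Finset.mem_univ u)
    have h2 : ident v ≤ m := Finset.le_sup (f := ident) (Finset.mem_univ v)
    exact huv (hinj (by omega))
  have h2 := hclog _ (Nat.mul_pos hD (Nat.two_pow_pos c))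
  have h3 := hclog _ (Nat.size_pos.2 hmpos)
  have hmL : m < L := by
    obtain ⟨w, hw⟩ := exists_ident_eq_sup ident
    rw [hm, ← hw]
    exact hL w
  have hlog := one_le_logb_of_injective hinj hL
  have hsize := size_le_logb_add_one (by omega) hmL
  have h4 : T ≤ 72 * (G.diam * m.size) := by
    calc T ≤ 18 * 2 ^ J := hT
      _ ≤ 18 * (2 * (G.diam * (2 * m.size))) := by gcongr; exact h2.trans (by gcongr)
      _ = _ := by ring
  calc (T : ℝ) ≤ 72 * (G.diam * m.size) := by exact_mod_cast h4
    _ ≤ 72 * (G.diam * (2 * Real.logb 2 L)) := by gcongr; linarith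
    _ = _ := by ring

end ElectionRuns

theorem electsLeader_elect : ElectsLeader elect := by
  refine ⟨144, fun V _ _ G _ ident L hG hinj hL => ?_⟩
  obtain ⟨T, hT, hrun⟩ := exists_netRun_elect hG hinj hL
  exact ⟨T, hT, hrun.outputsAt⟩

/-! ### Beep waves -/

theorem length_encode (s : List Bool) : (encode s).length = 2 * s.length + 4 := by
  have : (s.flatMap fun b => [b, b]).length = 2 * s.length := by
    induction s with
    | nil => rfl
    | cons b s ih => simp [ih]; omega
  simp [encode, this]

theorem decodeBody_append (s r : List Bool) :
    decodeBody ((s.flatMap fun b => [b, b]) ++ [true, false] ++ r) = some s := by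
  induction s with
  | nil => simp [decodeBody]
  | cons b s ih => cases b <;> simp_all [decodeBody]

theorem decode_encode_append (s r : List Bool) : decode (encode s ++ r) = some s := by
  simpa [encode, decode] using decodeBody_append s r

theorem decodeBody_take (s : List Bool) (n : ℕ) (hn : n < 2 * s.length + 2) :
    decodeBody (((s.flatMap fun b => [b, b]) ++ [true, false]).take n) = none := by
  induction s generalizing n with
  | nil =>
    have : n = 0 ∨ n = 1 := by simp at hn; omega
    rcases this with rfl | rfl <;> simp [decodeBody]
  | cons b s ih =>
    rcases n with _ | _ | n
    · simp [decodeBody]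
    · cases b <;> simp [decodeBody]
    · have := ih n (by simp at hn; omega)
      cases b <;> simp_all [decodeBody]

/-- Together with `decode_encode_append`: a receiver recognises the end of the message exactly on
reading the last bit of the code word, without knowing its length beforehand. -/
theorem decode_take_encode (s : List Bool) (n : ℕ) (hn : n < (encode s).length) :
    decode ((encode s).take n) = none := by
  rw [length_encode] at hn
  rcases n with _ | _ | n
  · simp [decode]
  · simp [encode, decode]
  · simpa [encode, decode] using decodeBody_take s n (by omega)

theorem map_heard_range (l : List Bool) (n : ℕ) :
    (List.range n).map (heard l) = l.take n ++ List.replicate (n - l.length) false := by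
  refine List.ext_getElem (by simp; omega) fun i h₁ h₂ => ?_
  simp only [List.length_map, List.length_range] at h₁
  rw [List.getElem_map, List.getElem_range, heard]
  rcases lt_or_ge i l.length with h | h
  · rw [List.getElem_append_left (by simp; omega)]
    simp [h]
  · rw [List.getElem_append_right (by simp; omega)]
    simp [h]

/-- Does a node at distance `d` from the source of a beep wave with message `s` beep in
time-step `n`? -/
def waveBeep (s : List Bool) (d n : ℕ) : Bool :=
  decide (d ≤ n ∧ (n - d) % 3 = 0) && heard (encode s) ((n - d) / 3)

theorem waveBeep_add (s : List Bool) (d k : ℕ) :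
    waveBeep s d (d + 3 * k) = heard (encode s) k := by
  simp [waveBeep]

theorem waveBeep_eq_true_iff (s : List Bool) (d n : ℕ) :
    waveBeep s d n = true ↔ ∃ k, n = d + 3 * k ∧ heard (encode s) k = true := by
  constructor
  · intro h
    simp only [waveBeep, Bool.and_eq_true, decide_eq_true_eq] at h
    exact ⟨_, by omega, h.2⟩
  · rintro ⟨k, rfl, hk⟩
    rw [waveBeep_add, hk]

theorem firstHeard_eq_some_iff (h : List Bool) (f : ℕ) :
    firstHeard h = some f ↔ heard h f = true ∧ ∀ n < f, heard h n = false := by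
  rw [firstHeard, List.findIdx?_eq_some_iff_getElem]
  constructor
  · rintro ⟨hf, h1, h2⟩
    refine ⟨by simpa [heard, hf] using h1, fun n hn => ?_⟩
    simpa [heard, hn.trans hf] using h2 n hn
  · rintro ⟨h1, h2⟩
    have hf : f < h.length := by
      by_contra hf
      rw [heard_of_length_le (by omega)] at h1
      exact absurd h1 (by simp)
    refine ⟨hf, by simpa [heard, hf] using h1, fun n hn => ?_⟩
    simpa [heard, hn.trans hf] using h2 n hn

theorem firstHeard_eq_none_iff (h : List Bool) :
    firstHeard h = none ↔ ∀ n, heard h n = false := by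
  rw [firstHeard, List.findIdx?_eq_none_iff]
  constructor
  · intro hh n
    rcases lt_or_ge n h.length with hn | hn
    · simpa [heard, hn] using hh h[n] (List.getElem_mem hn)
    · exact heard_of_length_le hn
  · intro hh x hx
    obtain ⟨n, hn, rfl⟩ := List.getElem_of_mem hx
    simpa [heard, hn] using hh n

theorem heard_obs_eq (B H : ℕ → Bool) (i t : ℕ) :
    heard (obs B H t) i = (decide (i < t) && (!B i && H i)) := by
  rcases lt_or_ge i t with h | h
  · simp [heard_obs B H h, h]
  · rw [heard_of_length_le (by simpa using h)]
    simp [h]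

section WaveFollow

variable {s : List Bool} {o : ℕ} {H : ℕ → Bool}

/-- The beeps that a node hears in a beep wave with message `s`, if the first of them occurs in
time-step `o`. -/
structure WaveStream (s : List Bool) (o : ℕ) (H : ℕ → Bool) : Prop where
  before : ∀ n < o, H n = false
  bit : ∀ k, H (o + 3 * k) = heard (encode s) k
  echo : ∀ k, H (o + 1 + 3 * k) = true → heard (encode s) k = true
  echo' : ∀ k, H (o + 2 + 3 * k) = true → heard (encode s) k = true

theorem heard_encode_zero (s : List Bool) : heard (encode s) 0 = true := by
  simp [encode, heard]

theorem waveBeep_eq_false {s : List Bool} {d n : ℕ} (h : n < d ∨ (n + 2 * d) % 3 ≠ 0) :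
    waveBeep s d n = false := by
  rw [← Bool.not_eq_true, waveBeep_eq_true_iff]
  rintro ⟨k, rfl, -⟩
  omega

/-- Modulo 3 the three neighbouring layers beep at different times. Beeps of the previous layer are
relayed one step later. Those of the own layer coincide with a beep of the node itself and go
unheard. Those of the next layer come one step after that beep and are suppressed by the relay rule.
-/
theorem relays_obs (hH : WaveStream s o H) (n : ℕ) :
    relays (obs (waveBeep s (o + 1)) H n).reverse = waveBeep s (o + 1) n := by
  induction n using Nat.strong_induction_on with
  | _ n ih =>
  rcases n with _ | _ | n
  · rw [waveBeep_eq_false (by omega)]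
    rfl
  · have h0 : waveBeep s (o + 1) 0 = false := waveBeep_eq_false (by omega)
    rcases Nat.eq_zero_or_pos o with rfl | ho
    · have := hH.bit 0
      have := waveBeep_add s (0 + 1) 0
      simp_all [obs, relays]
    · rw [waveBeep_eq_false (by omega)]
      simp [obs, relays, hH.before 0 ho]
  · have ihn := ih n (by omega)
    rw [obs_succ, obs_succ, List.reverse_append, List.reverse_append]
    simp only [List.reverse_cons, List.reverse_nil, List.nil_append, List.cons_append, relays, ihn]
    rcases lt_or_ge (n + 1) o with h | h
    · rw [hH.before _ h, waveBeep_eq_false (n := n + 1 + 1) (by omega)]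
      simp
    · obtain ⟨k, hk⟩ : ∃ k, n + 1 = o + 3 * k ∨ n + 1 = o + 1 + 3 * k ∨ n + 1 = o + 2 + 3 * k :=
        ⟨(n + 1 - o) / 3, by omega⟩
      rcases hk with hk | hk | hk
      · rw [waveBeep_eq_false (n := n + 1) (by omega), waveBeep_eq_false (n := n) (by omega), hk,
          show o + 3 * k + 1 = o + 1 + 3 * k by ring, waveBeep_add, hH.bit]
        simp
      · rw [waveBeep_eq_false (n := n + 1 + 1) (by omega), hk, waveBeep_add]
        have := hH.echo k
        cases h1 : heard (encode s) k <;> simp_all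
      · rw [waveBeep_eq_false (n := n + 1 + 1) (by omega), hk]
        have hn : n = o + 1 + 3 * k := by omega
        rw [hn, waveBeep_add]
        have := hH.echo' k
        cases h1 : heard (encode s) k <;> simp_all

theorem heard_obs_wave (hH : WaveStream s o H) {k n : ℕ} (hk : o + 3 * k < n) :
    heard (obs (waveBeep s (o + 1)) H n) (o + 3 * k) = heard (encode s) k := by
  rw [heard_obs _ _ hk, hH.bit, waveBeep_eq_false (by omega)]
  simp

/-- The last bit of the code word is heard in step `o + 3 * ((encode s).length - 1)`, and it belongs
to the history once `n` exceeds this number; hence the `n + 2`. -/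
theorem received_obs (hH : WaveStream s o H) (n : ℕ) :
    received (obs (waveBeep s (o + 1)) H n) =
      if o + 3 * (encode s).length ≤ n + 2 then some (o, s) else none := by
  rcases lt_or_ge o n with hn | hn
  · have hf : firstHeard (obs (waveBeep s (o + 1)) H n) = some o := by
      rw [firstHeard_eq_some_iff]
      constructor
      · simpa [heard_encode_zero] using heard_obs_wave hH (k := 0) (n := n) (by simpa using hn)
      · intro m hm
        rw [heard_obs _ _ (hm.trans hn), hH.before m hm]
        simp
    have hbits : ((List.range ((n - o + 2) / 3)).map fun i =>
        heard (obs (waveBeep s (o + 1)) H n) (o + 3 * i)) =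
        (List.range ((n - o + 2) / 3)).map (heard (encode s)) := by
      refine List.map_congr_left fun i hi => heard_obs_wave hH ?_
      rw [List.mem_range] at hi
      omega
    rw [received, hf, Option.bind_some, length_obs, hbits, map_heard_range]
    split
    · rename_i h
      rw [List.take_of_length_le (by omega), decode_encode_append]
      rfl
    · rename_i h
      rw [Nat.sub_eq_zero_of_le (show (n - o + 2) / 3 ≤ (encode s).length by omega), List.replicate_zero, List.append_nil,
        decode_take_encode _ _ (by omega)]
      rfl
  · have hf : firstHeard (obs (waveBeep s (o + 1)) H n) = none := by
      rw [firstHeard_eq_none_iff]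
      intro m
      rw [heard_obs_eq]
      rcases lt_or_ge m n with hm | hm
      · simp [hH.before m (hm.trans_le hn)]
      · simp [hm]
    rw [received, hf, if_neg]
    · rfl
    · rw [length_encode]
      omega

theorem localRun_waveFollow (hH : WaveStream s o H) (dur : List Bool → ℕ)
    (hdur : o + 3 * (encode s).length ≤ dur s + 2) :
    LocalRun (waveFollow dur) H (dur s) (o + 1, s) (waveBeep s (o + 1)) := by
  constructor
  · intro t ht
    rw [waveFollow, received_obs hH, relays_obs hH, length_obs]
    by_cases h : o + 3 * (encode s).length ≤ t + 2
    · simp [h, not_le.2 ht]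
    · simp [h]
  · rw [waveFollow, received_obs hH, if_pos hdur]
    simp

theorem localRun_waveSend (dur : ℕ) (s : List Bool) (H : ℕ → Bool) :
    LocalRun (waveSend dur s) H dur (0, s) (waveBeep s 0) := by
  constructor
  · intro t ht
    simp [waveSend, not_le.2 ht, waveBeep]
    rfl
  · simp [waveSend]

end WaveFollow

section WaveRuns

variable {V : Type} [Fintype V] {G : SimpleGraph V} [DecidableRel G.Adj]

/-- Neighbours lie in the layers `o`, `o + 1`, `o + 2`. The first of these is inhabited and delivers
every bit; the other two can only repeat ones one or two steps later. -/
theorem waveStream_hear (hG : G.Connected) (l : V) (s : List Bool) {v : V} {o : ℕ}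
    (hv : G.dist l v = o + 1) :
    WaveStream s o (hear G (fun u => waveBeep s (G.dist l u)) v) := by
  have key : ∀ n, hear G (fun u => waveBeep s (G.dist l u)) v n = true ↔
      ∃ u, G.Adj v u ∧ ∃ k, n = G.dist l u + 3 * k ∧ heard (encode s) k = true := by
    simp [hear, waveBeep_eq_true_iff]
  have hd : ∀ u, G.Adj v u → G.dist l u = o ∨ G.dist l u = o + 1 ∨ G.dist l u = o + 2 := by
    intro u hu
    have h1 := dist_le_succ hG l hu
    have h2 := dist_le_succ hG l hu.symm
    omega
  constructor
  · intro n hn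
    rw [← Bool.not_eq_true, key]
    rintro ⟨u, hu, k, hk, -⟩
    have := hd u hu
    omega
  · intro k
    rw [Bool.eq_iff_iff, key]
    constructor
    · rintro ⟨u, hu, k', hk, hb⟩
      have := hd u hu
      rwa [show k = k' by omega]
    · intro hb
      obtain ⟨u, hu, hd⟩ := exists_adj_dist_eq hG hv
      exact ⟨u, hu, k, by omega, hb⟩
  · intro k
    rw [key]
    rintro ⟨u, hu, k', hk, hb⟩
    have := hd u hu
    rwa [show k = k' by omega]
  · intro k
    rw [key]
    rintro ⟨u, hu, k', hk, hb⟩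
    have := hd u hu
    rwa [show k = k' by omega]

theorem netRun_beepWave (hG : G.Connected) {l : V} {lead : V → Bool}
    (hl : ∀ v, lead v = true ↔ v = l) {D : ℕ} (hD : ∀ v, G.dist l v ≤ D) (s : V → List Bool) :
    NetRun G (fun v => beepWave D (lead v) (s v)) (3 * (encode (s l)).length + D)
      fun v => (G.dist l v, s l) := by
  refine ⟨fun v => waveBeep (s l) (G.dist l v), fun v => ?_⟩
  by_cases hv : lead v = true
  · obtain rfl := (hl v).1 hv
    simp only [beepWave, hv, if_true, SimpleGraph.dist_self]
    exact localRun_waveSend _ _ _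
  · simp only [beepWave, hv]
    have hne : l ≠ v := fun h => hv ((hl v).2 h.symm)
    obtain ⟨o, ho⟩ := Nat.exists_eq_succ_of_ne_zero (hG.pos_dist_of_ne hne).ne'
    have hDv := hD v
    rw [ho]
    exact localRun_waveFollow (waveStream_hear hG l (s l) ho)
      (fun s' => 3 * (encode s').length + D) (by omega)

end WaveRuns

/-! ### Phases ending at node-dependent times, followed by a beep wave. -/

section Phases

/-- A beeping node is deaf, but it knows its own beeps. So the test detects three steps of silence
in the whole closed neighbourhood. -/
theorem quiet_obs {B H beeped : ℕ → Bool} {t : ℕ} (h : ∀ n < t, beeped n = B n) :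
    quiet (obs B H t) beeped = true ↔
      3 ≤ t ∧ ∀ i, 1 ≤ i → i ≤ 3 → B (t - i) = false ∧ H (t - i) = false := by
  have key : ∀ i, 1 ≤ i → 3 ≤ t →
      ((!heard (obs B H t) (t - i) && !beeped (t - i)) = true ↔
        B (t - i) = false ∧ H (t - i) = false) := by
    intro i hi ht
    rw [heard_obs _ _ (by omega), h _ (by omega)]
    cases B (t - i) <;> simp
  simp only [quiet, length_obs, Bool.and_eq_true, decide_eq_true_eq, List.all_eq_true]
  constructor
  · rintro ⟨ht, hall⟩
    exact ⟨ht, fun i h1 h3 => (key i h1 ht).1 (Bool.and_eq_true_iff.2 (by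
      have := hall i (by simp; omega)
      exact this))⟩
  · rintro ⟨ht, hall⟩
    refine ⟨ht, fun i hi => ?_⟩
    have : 1 ≤ i ∧ i ≤ 3 := by
      simp at hi
      omega
    exact Bool.and_eq_true_iff.1 ((key i this.1 ht).2 (hall i this.1 this.2))

variable {α : Type} {V : Type} {G : SimpleGraph V}

/-- The beeps of a phase with beeps `A` that is followed by a beep wave from `l` with message `s`
in time-step `τ`. -/
noncomputable def thenWave (G : SimpleGraph V) (A : V → ℕ → Bool) (l : V) (s : List Bool) (τ : ℕ) (v : V)
    (n : ℕ) : Bool :=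
  A v n || (decide (τ ≤ n) && waveBeep s (G.dist l v) (n - τ))

theorem thenWave_of_lt {A : V → ℕ → Bool} {l : V} {s : List Bool} {τ : ℕ} {v : V} {n : ℕ}
    (h : n < τ + G.dist l v) : thenWave G A l s τ v n = A v n := by
  rw [thenWave]
  rcases lt_or_ge n τ with h' | h'
  · simp [not_le.2 h']
  · rw [waveBeep_eq_false (by omega)]
    simp

variable [Fintype V] [DecidableRel G.Adj]

theorem hear_thenWave_of_lt (hG : G.Connected) {A : V → ℕ → Bool} {l : V} {s : List Bool}
    {τ : ℕ} {v : V} {n : ℕ} (h : n + 1 < τ + G.dist l v) :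
    hear G (thenWave G A l s τ) v n = hear G A v n := by
  simp only [hear]
  congr 1
  rw [eq_iff_iff]
  refine exists_congr fun u => and_congr_right fun hu => ?_
  have := dist_le_succ hG l hu
  rw [thenWave_of_lt (by omega)]

/-- Change of clock: the wave starts in step `τ` and the node turns to it in step `t`, no later than
the arrival `τ + o`. -/
theorem WaveStream.delay {s : List Bool} {o : ℕ} {W H : ℕ → Bool} (hW : WaveStream s o W)
    {t τ : ℕ} (ht : t ≤ τ + o) (hH : ∀ n, H n = (decide (τ ≤ t + n) && W (t + n - τ))) :
    WaveStream s (τ + o - t) H := by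
  constructor
  · intro n hn
    rw [hH]
    rcases lt_or_ge (t + n) τ with h | h
    · simp [not_le.2 h]
    · rw [hW.before _ (by omega)]
      simp
  · intro k
    rw [hH, show t + (τ + o - t + 3 * k) - τ = o + 3 * k by omega, hW.bit,
      decide_eq_true (by omega)]
    simp
  · intro k
    rw [hH, show t + (τ + o - t + 1 + 3 * k) - τ = o + 1 + 3 * k by omega]
    intro h
    exact hW.echo k (Bool.and_eq_true_iff.1 h).2
  · intro k
    rw [hH, show t + (τ + o - t + 2 + 3 * k) - τ = o + 2 + 3 * k by omega]
    intro h
    exact hW.echo' k (Bool.and_eq_true_iff.1 h).2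

/-- A phase that ends at a non-source before the first beep of the wave arrives, and after the last
beep of the phase at this node and its neighbours, can be followed by the beep wave. -/
theorem localRun_bind_waveFollow (hG : G.Connected) {A : V → ℕ → Bool} {l v : V} {s : List Bool}
    {τ t o : ℕ} {a : α} (hv : G.dist l v = o + 1) (ht : t ≤ τ + o)
    (hsilent : ∀ u, u = v ∨ G.Adj v u → ∀ n ≥ t, A u n = false) {p : Protocol α}
    (hp : LocalRun p (hear G A v) t a (A v)) (dur : α → List Bool → ℕ)
    (hdur : τ + o + 3 * (encode s).length ≤ t + dur a s + 2) :
    LocalRun (p >>= fun x => waveFollow (dur x) >>= fun r => pure (ofBits r.2))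
      (hear G (thenWave G A l s τ) v) (t + dur a s) (ofBits s) (thenWave G A l s τ v) := by
  refine LocalRun.bind (a := a) (hp.congr (fun n hn => ?_) fun n hn => ?_) ?_
  · rw [thenWave_of_lt (by omega)]
  · rw [hear_thenWave_of_lt hG (by omega)]
  · have hW := (waveStream_hear hG l s hv).delay ht
      (H := fun n => hear G (thenWave G A l s τ) v (t + n)) fun n => by
        rw [Bool.eq_iff_iff]
        simp only [hear, thenWave, decide_eq_true_eq, Bool.or_eq_true, Bool.and_eq_true]
        constructor
        · rintro ⟨u, hu, h | h⟩
          · rw [hsilent u (Or.inr hu) _ (by omega)] at h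
            exact absurd h (by simp)
          · exact ⟨h.1, u, hu, h.2⟩
        · rintro ⟨h, u, hu, h'⟩
          exact ⟨u, hu, Or.inr ⟨h, h'⟩⟩
    refine LocalRun.bind (T₂ := 0) ((localRun_waveFollow hW (dur a) (by omega)).congr
      (fun n _ => ?_) fun _ _ => rfl) (LocalRun.pure _ _ _)
    rw [thenWave, hsilent v (Or.inl rfl) _ (by omega), hv, Bool.eq_iff_iff]
    simp only [Bool.false_or, Bool.and_eq_true, decide_eq_true_eq, waveBeep_eq_true_iff]
    constructor
    · rintro ⟨k, hk, hb⟩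
      exact ⟨by omega, k, by omega, hb⟩
    · rintro ⟨h, k, hk, hb⟩
      exact ⟨k, by omega, hb⟩

theorem localRun_bind_waveSend {A : V → ℕ → Bool} {l : V} {s : List Bool}
    {τ : ℕ} {a : α} (hsilent : ∀ n ≥ τ, A l n = false) {p : Protocol α}
    (hp : LocalRun p (hear G A l) τ a (A l)) (dur : α → ℕ) (str : α → List Bool)
    (hs : str a = s) :
    LocalRun (p >>= fun x => waveSend (dur x) (str x) >>= fun _ => pure x)
      (hear G (thenWave G A l s τ) l) (τ + dur a) a (thenWave G A l s τ l) := by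
  subst hs
  refine LocalRun.bind (a := a) ((hp.congr (fun n hn => ?_) fun n hn => ?_)) ?_
  · rw [thenWave_of_lt (by omega)]
  · simp only [hear]
    congr 1
    rw [eq_iff_iff]
    refine exists_congr fun u => and_congr_right fun hu => ?_
    rw [thenWave_of_lt (by omega)]
  · refine LocalRun.bind (T₂ := 0) ((localRun_waveSend (dur a) (str a) _).congr
      (fun n _ => ?_) fun _ _ => rfl) (LocalRun.pure _ _ _)
    rw [thenWave, hsilent _ (by omega)]
    simp

end Phases

/-! ### Collection of superposed strings at the leader. -/

section Collection

variable {V : Type} {G : SimpleGraph V}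

/-- Some shortest path from `l` to `u` passes through `v`. -/
def Below (G : SimpleGraph V) (l v u : V) : Prop := G.dist l u = G.dist l v + G.dist v u

theorem below_self (l v : V) : Below G l v v := by simp [Below]

theorem below_root (l u : V) : Below G l l u := by simp [Below]

theorem Below.of_adj (hG : G.Connected) {l v w u : V} (hvw : G.Adj v w)
    (hd : G.dist l w = G.dist l v + 1) (h : Below G l w u) : Below G l v u := by
  unfold Below at *
  have h1 : G.dist l u ≤ G.dist l v + G.dist v u := hG.dist_triangle
  have h2 := dist_le_succ hG u hvw
  rw [G.dist_comm (u := u), G.dist_comm (u := u)] at h2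
  omega

theorem Below.exists_adj (hG : G.Connected) {l v u : V} (h : Below G l v u) (hne : u ≠ v) :
    ∃ w, G.Adj v w ∧ G.dist l w = G.dist l v + 1 ∧ Below G l w u := by
  obtain ⟨n, hn⟩ := Nat.exists_eq_succ_of_ne_zero (hG.pos_dist_of_ne hne).ne'
  obtain ⟨w, hvw, hw⟩ := exists_adj_dist_eq hG hn
  refine ⟨w, hvw, ?_⟩
  unfold Below at *
  rw [G.dist_comm] at hn hw
  have h1 : G.dist l u ≤ G.dist l w + G.dist w u := hG.dist_triangle
  have h2 := dist_le_succ hG l hvw.symm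
  omega

open Classical in
/-- The beeps of a collection of the strings `s`. -/
noncomputable def collectTrace (G : SimpleGraph V) (D : ℕ) (l : V) (s : V → List Bool) (v : V)
    (t : ℕ) : Bool :=
  decide (0 < G.dist l v ∧ ∃ i, t + G.dist l v = D + 3 * i ∧
    ∃ u, Below G l v u ∧ heard (s u) i = true)

theorem collectTrace_eq_true_iff {D : ℕ} {l : V} {s : V → List Bool} {v : V} {t : ℕ} :
    collectTrace G D l s v t = true ↔ 0 < G.dist l v ∧ ∃ i, t + G.dist l v = D + 3 * i ∧
      ∃ u, Below G l v u ∧ heard (s u) i = true := by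
  simp [collectTrace]

theorem collectTrace_eq_false {D : ℕ} {l : V} {s : V → List Bool} {v : V} {t : ℕ}
    (h : t + G.dist l v < D ∨ (t + G.dist l v + 2 * D) % 3 ≠ 0) :
    collectTrace G D l s v t = false := by
  rw [← Bool.not_eq_true, collectTrace_eq_true_iff]
  rintro ⟨-, i, hi, -⟩
  omega

theorem collectTrace_root {D : ℕ} {l : V} {s : V → List Bool} {t : ℕ} :
    collectTrace G D l s l t = false := by
  rw [← Bool.not_eq_true, collectTrace_eq_true_iff]
  simp

variable [Fintype V] [DecidableRel G.Adj]

theorem hear_collectTrace_eq_true_iff {D : ℕ} {l : V} {s : V → List Bool} {v : V} {t : ℕ} :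
    hear G (collectTrace G D l s) v t = true ↔ ∃ w, G.Adj v w ∧ 0 < G.dist l w ∧
      ∃ i, t + G.dist l w = D + 3 * i ∧ ∃ u, Below G l w u ∧ heard (s u) i = true := by
  simp only [hear, decide_eq_true_eq, collectTrace_eq_true_iff]

/-- One step before its own turn for bit `i`, a node can hear only the next layer, since the other
two beep in other residues modulo 3. Thus it learns the bit of all strings strictly below it, along
shortest paths. -/
theorem collectBeeps_obs (hG : G.Connected) {D : ℕ} {l : V} (hD : ∀ v, G.dist l v ≤ D)
    (s : V → List Bool) (v : V) {t t' : ℕ} (ht : t ≤ t') :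
    collectBeeps D (G.dist l v) (s v)
      (obs (collectTrace G D l s v) (hear G (collectTrace G D l s) v) t') t =
      collectTrace G D l s v t := by
  rw [Bool.eq_iff_iff, collectTrace_eq_true_iff]
  simp only [collectBeeps, Bool.and_eq_true, Bool.or_eq_true, decide_eq_true_eq]
  constructor
  · rintro ⟨⟨⟨hd, hDt⟩, hmod⟩, h⟩
    refine ⟨hd, (t + G.dist l v - D) / 3, by omega, ?_⟩
    rcases h with h | ⟨h0, h⟩
    · exact ⟨v, below_self l v, h⟩
    · rw [heard_obs _ _ (by omega), Bool.and_eq_true, hear_collectTrace_eq_true_iff] at h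
      obtain ⟨-, w, hvw, -, i, hi, u, hu, hb⟩ := h
      have h1 := dist_le_succ hG l hvw
      have h2 := dist_le_succ hG l hvw.symm
      refine ⟨u, hu.of_adj hG hvw (by omega), ?_⟩
      rwa [show (t + G.dist l v - D) / 3 = i by omega]
  · rintro ⟨hd, i, hi, u, hu, hb⟩
    refine ⟨⟨⟨hd, by omega⟩, by omega⟩, ?_⟩
    rw [show (t + G.dist l v - D) / 3 = i by omega]
    by_cases hne : u = v
    · exact Or.inl (hne ▸ hb)
    · right
      obtain ⟨w, hvw, hw, hwu⟩ := hu.exists_adj hG hne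
      have h3 := hD w
      refine ⟨by omega, ?_⟩
      rw [heard_obs _ _ (by omega), collectTrace_eq_false (by omega), Bool.not_false,
        Bool.true_and, hear_collectTrace_eq_true_iff]
      exact ⟨w, hvw, by omega, i, by omega, u, hwu, hb⟩

theorem collectedBit_obs (hG : G.Connected) {D : ℕ} (hD1 : 1 ≤ D) {l : V} (s : V → List Bool)
    {i t : ℕ} (ht : 3 * i + D ≤ t) :
    collectedBit D (s l) (obs (collectTrace G D l s l) (hear G (collectTrace G D l s) l) t) i = true
      ↔ ∃ u, heard (s u) i = true := by
  simp only [collectedBit, Bool.or_eq_true]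
  rw [heard_obs _ _ (by omega), collectTrace_root, Bool.not_false, Bool.true_and,
    hear_collectTrace_eq_true_iff]
  constructor
  · rintro (h | ⟨w, hw, hw0, j, hj, u, hu, hb⟩)
    · exact ⟨l, h⟩
    · have := SimpleGraph.dist_eq_one_iff_adj.2 hw
      exact ⟨u, by rwa [show i = j by omega]⟩
  · rintro ⟨u, hu⟩
    by_cases hne : u = l
    · exact Or.inl (hne ▸ hu)
    · right
      obtain ⟨w, hvw, hw, hwu⟩ := (below_root (G := G) l u).exists_adj hG hne
      rw [SimpleGraph.dist_self] at hw
      exact ⟨w, hvw, by omega, i, by omega, u, hwu, hu⟩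

open Classical in
/-- The first `p` bits of the superposition of the strings `s`. -/
noncomputable def superposition (s : V → List Bool) (p : ℕ) : List Bool :=
  (List.range p).map fun i => decide (∃ u, heard (s u) i = true)

/-- The summand `18 + D` is the preliminary wave, whose code word has six bits, and `3 * p + D` is
the collection proper. -/
theorem netRun_collectMessages (hG : G.Connected) {l : V} {lead : V → Bool}
    (hl : ∀ v, lead v = true ↔ v = l) {D : ℕ} (hD1 : 1 ≤ D) (hD : ∀ v, G.dist l v ≤ D)
    (s : V → List Bool) (p : ℕ) :
    ∃ out : V → List Bool,
      NetRun G (fun v => collectMessages D (lead v) (s v) p) (18 + D + (3 * p + D)) out ∧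
      out l = superposition s p := by
  set B := collectTrace G D l s with hB
  refine ⟨fun v => (List.range p).map (collectedBit D (s v) (obs (B v) (hear G B v) (3 * p + D))),
    ?_, ?_⟩
  · have h1 := netRun_beepWave hG hl hD fun _ => [true]
    rw [length_encode] at h1
    refine h1.bind (f := fun v (r : ℕ × List Bool) => ((fun h =>
      if 3 * p + D ≤ h.length then .halt ((List.range p).map (collectedBit D (s v) h))
      else .ofBit (collectBeeps D r.1 (s v) h h.length)) : Protocol (List Bool))) ⟨B, fun v => ⟨?_, ?_⟩⟩
    · intro t ht
      simp only [length_obs, not_le.2 ht, if_false]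
      rw [collectBeeps_obs hG hD s v le_rfl]
    · simp
  · refine List.map_congr_left fun i hi => ?_
    rw [List.mem_range] at hi
    rw [Bool.eq_iff_iff, collectedBit_obs hG hD1 s (by omega)]
    simp

end Collection

/-! ### Binary expansions and strings of ones. -/

theorem toBits_succ (w x : ℕ) : toBits (w + 1) x = toBits w (x / 2) ++ [x.testBit 0] := by
  simp only [toBits, List.range_succ, List.map_append, List.map_cons, List.map_nil]
  congr 1
  · refine List.map_congr_left fun i hi => ?_
    rw [List.mem_range] at hi
    rw [Nat.testBit_div_two]
    congr 1
    omega
  · simp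

@[simp] theorem length_toBits (w x : ℕ) : (toBits w x).length = w := by simp [toBits]

theorem ofBits_append_singleton (s : List Bool) (b : Bool) :
    ofBits (s ++ [b]) = 2 * ofBits s + b.toNat := by simp [ofBits]

theorem ofBits_toBits {w x : ℕ} (h : x < 2 ^ w) : ofBits (toBits w x) = x := by
  induction w generalizing x with
  | zero =>
    have : x = 0 := by simpa using h
    simp [toBits, ofBits, this]
  | succ w ih =>
    rw [toBits_succ, ofBits_append_singleton, ih (by rw [pow_succ] at h; omega),
      Nat.testBit_zero]
    rcases Nat.mod_two_eq_zero_or_one x with hx | hx <;> simp [hx] <;> omega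

theorem ofBits_toBits_size (x : ℕ) : ofBits (toBits x.size x) = x :=
  ofBits_toBits (Nat.lt_size_self x)

theorem heard_replicate_true (k i : ℕ) :
    heard (List.replicate k true) i = true ↔ i < k := by
  rcases lt_or_ge i k with h | h
  · simp [heard, h]
  · simp [heard, h]

/-! ### Determination of the largest message length. -/

section MessageLength

variable {V : Type} [Fintype V] {G : SimpleGraph V} [DecidableRel G.Adj]

theorem localRun_lengthLeader (hG : G.Connected) {D : ℕ} (hD1 : 1 ≤ D) {l : V} {len : V → ℕ}
    {p : ℕ} (hp : ∀ v, len v ≤ p) (hex : ∃ v, len v = p) :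
    LocalRun (lengthLeader D (List.replicate (len l) true))
      (hear G (collectTrace G D l fun v => List.replicate (len v) true) l) (3 * (p + 1) + D) p
      (collectTrace G D l (fun v => List.replicate (len v) true) l) := by
  have hbit : ∀ {t i : ℕ}, 3 * i + D ≤ t → (collectedBit D (List.replicate (len l) true)
      (obs (collectTrace G D l (fun v => List.replicate (len v) true) l)
        (hear G (collectTrace G D l fun v => List.replicate (len v) true) l) t) i = true ↔
      i < p) := by
    intro t i ht
    refine (collectedBit_obs hG hD1 (fun v => List.replicate (len v) true) ht).trans ?_
    simp only [heard_replicate_true]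
    constructor
    · rintro ⟨u, hu⟩
      exact hu.trans_le (hp u)
    · intro hi
      obtain ⟨u, hu⟩ := hex
      exact ⟨u, hu ▸ hi⟩
  constructor
  · intro t ht
    rw [collectTrace_root, lengthLeader, List.find?_eq_none.2]
    · rfl
    · intro i _
      rw [length_obs]
      intro h
      simp only [Bool.and_eq_true, decide_eq_true_eq, Bool.not_eq_eq_eq_not, Bool.not_true] at h
      rw [(hbit (by omega)).2 (by omega)] at h
      exact absurd h.2 (by simp)
  · rw [lengthLeader, List.find?_range_eq_some.2]
    rw [length_obs]
    refine ⟨?_, ?_, ?_⟩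
    · simp only [Bool.and_eq_true, decide_eq_true_eq, le_refl, true_and,
        Bool.not_eq_eq_eq_not, Bool.not_true, ← Bool.not_eq_true]
      rw [hbit (by omega)]
      omega
    · simp
      omega
    · intro i hi
      rw [(hbit (by omega)).2 hi]
      simp

/-- In strings `1⋯1` a later beep of a node implies beeps in all its earlier turns. As each node has
a turn in any three consecutive steps, three quiet steps mean permanent silence. The bound on `t`
says that the node is ready before the leader's wave arrives. -/
theorem localRun_lengthFollow (hG : G.Connected) {D : ℕ} {l v : V} (hD : ∀ v, G.dist l v ≤ D)
    {len : V → ℕ} {p : ℕ} (hp : ∀ v, len v ≤ p) {o : ℕ} (hv : G.dist l v = o + 1) :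
    ∃ t ≤ 3 * (p + 1) + D + o,
      (∀ u, u = v ∨ G.Adj v u → ∀ n ≥ t,
        collectTrace G D l (fun v => List.replicate (len v) true) u n = false) ∧
      LocalRun (lengthFollow D (G.dist l v) (List.replicate (len v) true))
        (hear G (collectTrace G D l fun v => List.replicate (len v) true) v) t t
        (collectTrace G D l (fun v => List.replicate (len v) true) v) := by
  set s : V → List Bool := fun v => List.replicate (len v) true with hs
  set A := collectTrace G D l s with hA
  have hA' : ∀ u n, A u n = true ↔ 0 < G.dist l u ∧ ∃ i, n + G.dist l u = D + 3 * i ∧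
      ∃ w, Below G l u w ∧ i < len w := by
    intro u n
    rw [hA, collectTrace_eq_true_iff]
    simp only [hs, heard_replicate_true]
  have hd : ∀ u, u = v ∨ G.Adj v u →
      G.dist l u = o ∨ G.dist l u = o + 1 ∨ G.dist l u = o + 2 := by
    rintro u (rfl | hu)
    · omega
    · have h1 := dist_le_succ hG l hu
      have h2 := dist_le_succ hG l hu.symm
      omega
  have hquiet : ∀ t, (D + 2 ≤ (obs (A v) (hear G A v) t).length + G.dist l v ∧
      quiet (obs (A v) (hear G A v) t)
        (collectBeeps D (G.dist l v) (s v) (obs (A v) (hear G A v) t)) = true) ↔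
      D + 2 ≤ t + (o + 1) ∧ 3 ≤ t ∧ ∀ u, u = v ∨ G.Adj v u →
        ∀ i, 1 ≤ i → i ≤ 3 → A u (t - i) = false := by
    intro t
    rw [quiet_obs fun n hn => collectBeeps_obs hG hD s v hn.le, length_obs, hv]
    refine and_congr_right fun _ => and_congr_right fun _ => ?_
    constructor
    · rintro h u (rfl | hu) i h1 h3
      · exact (h i h1 h3).1
      · have := (h i h1 h3).2
        simp only [hear, decide_eq_false_iff_not, not_exists, not_and, Bool.not_eq_true] at this
        exact this u hu
    · intro h i h1 h3
      refine ⟨h v (Or.inl rfl) i h1 h3, ?_⟩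
      simp only [hear, decide_eq_false_iff_not, not_exists, not_and, Bool.not_eq_true]
      exact fun u hu => h u (Or.inr hu) i h1 h3
  have hex : D + 2 ≤ (3 * (p + 1) + D + o) + (o + 1) ∧ 3 ≤ 3 * (p + 1) + D + o ∧
      ∀ u, u = v ∨ G.Adj v u → ∀ i, 1 ≤ i → i ≤ 3 →
        A u (3 * (p + 1) + D + o - i) = false := by
    refine ⟨by omega, by omega, fun u hu i h1 h3 => ?_⟩
    rw [← Bool.not_eq_true, hA']
    rintro ⟨-, j, hj, w, -, hw⟩
    have := hp w
    have := hd u hu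
    omega
  have hex' := (hquiet _).2 hex
  have hexists : ∃ t, D + 2 ≤ (obs (A v) (hear G A v) t).length + G.dist l v ∧
      quiet (obs (A v) (hear G A v) t)
        (collectBeeps D (G.dist l v) (s v) (obs (A v) (hear G A v) t)) = true := ⟨_, hex'⟩
  classical
  refine ⟨Nat.find hexists, Nat.find_min' hexists hex', ?_, ?_, ?_⟩
  · obtain ⟨h1, h2, h3⟩ := (hquiet _).1 (Nat.find_spec hexists)
    set t := Nat.find hexists
    intro u hu n hn
    rw [← Bool.not_eq_true, hA']
    rintro ⟨hu0, j, hj, w, hw, hjw⟩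
    have hdu := hd u hu
    -- The turn of `u` among the last three steps. It belongs to a genuine bit `k ≥ 0` because the
    -- threshold `D + 2 ≤ t + d` leaves `D + 1 ≤ t + G.dist l u` even for a neighbour closer to the
    -- leader.
    obtain ⟨i, hi1, hi3, k, hk⟩ : ∃ i, 1 ≤ i ∧ i ≤ 3 ∧ ∃ k, t - i + G.dist l u = D + 3 * k := by
      have : (t + G.dist l u - D) % 3 < 3 := Nat.mod_lt _ (by norm_num)
      have hle : D + 1 ≤ t + G.dist l u := by omega
      rcases Nat.eq_zero_or_pos ((t + G.dist l u - D) % 3) with h0 | h0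
      · exact ⟨3, by omega, by omega, (t + G.dist l u - D) / 3 - 1, by omega⟩
      · exact ⟨(t + G.dist l u - D) % 3, by omega, by omega, (t + G.dist l u - D) / 3, by omega⟩
    have := h3 u hu i hi1 hi3
    rw [← Bool.not_eq_true, hA'] at this
    exact this ⟨hu0, k, hk, w, hw, by omega⟩
  · intro t ht
    rw [lengthFollow, if_neg (Nat.find_min hexists ht), length_obs]
    rw [collectBeeps_obs hG hD s v le_rfl]
  · rw [lengthFollow, if_pos (Nat.find_spec hexists), length_obs]

theorem netRun_getMessageLength (hG : G.Connected) {l : V} {lead : V → Bool}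
    (hl : ∀ v, lead v = true ↔ v = l) {D : ℕ} (hD1 : 1 ≤ D) (hD : ∀ v, G.dist l v ≤ D)
    (len : V → ℕ) {p : ℕ} (hp : ∀ v, len v ≤ p) (hex : ∃ v, len v = p) :
    NetRun G (fun v => getMessageLength D (lead v) (len v))
      (18 + D + (3 * (p + 1) + D + (3 * (2 * p.size + 4) + D))) fun _ => p := by
  have h1 := netRun_beepWave hG hl hD fun _ => [true]
  rw [length_encode] at h1
  set A := collectTrace G D l (fun v => List.replicate (len v) true) with hA
  set c := toBits p.size p with hc
  have hclen : (encode c).length = 2 * p.size + 4 := by rw [length_encode, hc, length_toBits]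
  refine h1.bind (f := fun v (r : ℕ × List Bool) => if lead v then do
      let p ← lengthLeader D (List.replicate (len v) true)
      let _ ← beepWave D true (toBits p.size p)
      pure p
    else do
      let t ← lengthFollow D r.1 (List.replicate (len v) true)
      let w ← waveFollow fun s =>
        3 * (ofBits s + 1) + D + (3 * (encode s).length + D) - t
      pure (ofBits w.2)) ⟨thenWave G A l c (3 * (p + 1) + D), fun v => ?_⟩
  by_cases hv : lead v = true
  · obtain rfl := (hl v).1 hv
    simp only [hv, if_true]
    have := localRun_bind_waveSend (l := v) (s := c) (fun n _ => collectTrace_root)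
      (localRun_lengthLeader (l := v) hG hD1 hp hex) (fun p => 3 * (encode (toBits p.size p)).length + D)
      (fun p => toBits p.size p) rfl
    rw [← hc, hclen] at this
    exact this
  · simp only [hv]
    have hne : l ≠ v := fun h => hv ((hl v).2 h.symm)
    obtain ⟨o, ho⟩ := Nat.exists_eq_succ_of_ne_zero (hG.pos_dist_of_ne hne).ne'
    have hDv := hD v
    obtain ⟨t, ht, hsil, hrun⟩ := localRun_lengthFollow hG hD hp ho
    -- The decoded `p` reveals the leader's finishing time; subtracting its own elapsed time `t`
    -- lets each node stop at that moment.
    have hdur : t + (3 * (ofBits c + 1) + D + (3 * (encode c).length + D) - t) =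
        3 * (p + 1) + D + (3 * (2 * p.size + 4) + D) := by
      rw [hc, ofBits_toBits_size, ← hc, hclen]
      omega
    have := localRun_bind_waveFollow (s := c) (τ := 3 * (p + 1) + D) hG ho ht hsil hrun
      (fun t s => 3 * (ofBits s + 1) + D + (3 * (encode s).length + D) - t)
      (by rw [hclen] at *; omega)
    rw [hdur, hc, ofBits_toBits_size] at this
    exact this

end MessageLength

/-! ### Estimation of the diameter. -/

section Diameter

variable {V : Type} {G : SimpleGraph V}

open Classical in
/-- The beeps in the first part of the diameter estimation by `l`. -/
noncomputable def pingTrace (G : SimpleGraph V) (l v : V) (n : ℕ) : Bool :=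
  decide (n = G.dist l v ∨ (0 < G.dist l v ∧ G.dist l v ≤ n ∧ (n + 1 + G.dist l v) % 3 = 0 ∧
    ∃ u, Below G l v u ∧ n + G.dist l v ≤ 2 * G.dist l u + 2))

theorem pingTrace_eq_true_iff {l v : V} {n : ℕ} :
    pingTrace G l v n = true ↔
      n = G.dist l v ∨ (0 < G.dist l v ∧ G.dist l v ≤ n ∧ (n + 1 + G.dist l v) % 3 = 0 ∧
        ∃ u, Below G l v u ∧ n + G.dist l v ≤ 2 * G.dist l u + 2) := by
  simp [pingTrace]

/-- The duration of the first part of the diameter estimation at a leader of eccentricity `E`. -/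
def pingTime (E : ℕ) : ℕ := 2 * E + 5 - 2 * E % 3

variable [Fintype V] [DecidableRel G.Adj]

theorem hear_pingTrace_eq_true_iff {l v : V} {n : ℕ} :
    hear G (pingTrace G l) v n = true ↔ ∃ w, G.Adj v w ∧ pingTrace G l w n = true := by
  simp only [hear, decide_eq_true_eq]

/-- A neighbour of the leader above a farthest node beeps without gaps in its residue class up to
step `2 * E + 1`, and no acknowledgement arrives later. -/
theorem hear_pingTrace_root_eq_true_iff (hG : G.Connected) {l : V} {E : ℕ}
    (hE : ∀ v, G.dist l v ≤ E) (hex : ∃ v, G.dist l v = E) (hE1 : 1 ≤ E) (n : ℕ) :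
    hear G (pingTrace G l) l n = true ↔ n % 3 = 1 ∧ n ≤ 2 * E + 1 := by
  rw [hear_pingTrace_eq_true_iff]
  constructor
  · rintro ⟨w, hw, h⟩
    have h1 := SimpleGraph.dist_eq_one_iff_adj.2 hw
    rw [pingTrace_eq_true_iff, h1] at h
    rcases h with h | ⟨-, h2, h3, u, -, hu⟩
    · omega
    · have := hE u
      omega
  · rintro ⟨h1, h2⟩
    obtain ⟨u, hu⟩ := hex
    have hne : u ≠ l := by
      rintro rfl
      rw [SimpleGraph.dist_self] at hu
      omega
    obtain ⟨w, hlw, hw, hwu⟩ := (below_root (G := G) l u).exists_adj hG hne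
    rw [SimpleGraph.dist_self] at hw
    refine ⟨w, hlw, ?_⟩
    rw [pingTrace_eq_true_iff, hw]
    exact Or.inr ⟨by omega, by omega, by omega, u, hwu, by omega⟩

/-- The last beep is heard in step `2 * E + 1 - 2 * E % 3`; that step and three silent ones are over
after `pingTime E` steps. -/
theorem localRun_pingLeader (hG : G.Connected) {l : V} {E : ℕ}
    (hE : ∀ v, G.dist l v ≤ E) (hex : ∃ v, G.dist l v = E) (hE1 : 1 ≤ E) :
    LocalRun pingLeader (hear G (pingTrace G l) l) (pingTime E) (pingTime E + 1)
      (pingTrace G l l) := by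
  have hA : ∀ n, pingTrace G l l n = decide (n = 0) := by
    intro n
    rw [Bool.eq_iff_iff, pingTrace_eq_true_iff]
    simp
  have hdrop : ∀ t, 3 ≤ t → (true ∈ (obs (pingTrace G l l) (hear G (pingTrace G l) l) t).drop (t - 3) ↔
      ∃ n < t, t - 3 ≤ n ∧ n % 3 = 1 ∧ n ≤ 2 * E + 1) := by
    intro t ht
    obtain ⟨k, rfl⟩ := Nat.exists_eq_add_of_le' ht
    rw [Nat.add_sub_cancel, obs_add, List.drop_left' (length_obs _ _ _), true_mem_obs]
    simp only [hear_pingTrace_root_eq_true_iff hG hE hex hE1, hA, decide_eq_false_iff_not]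
    constructor
    · rintro ⟨n, hn, -, h1, h2⟩
      exact ⟨k + n, by omega, by omega, h1, h2⟩
    · rintro ⟨n, hn, hk, h1, h2⟩
      refine ⟨n - k, by omega, by omega, ?_⟩
      rw [Nat.add_sub_of_le hk]
      exact ⟨h1, h2⟩
  have hne : ∀ t, 0 < t → obs (pingTrace G l l) (hear G (pingTrace G l) l) t ≠ [] := by
    intro t ht h
    have := congrArg List.length h
    simp at this
    omega
  constructor
  · intro t ht
    rw [hA]
    rcases Nat.eq_zero_or_pos t with rfl | h0
    · rfl
    rw [pingLeader, if_neg (hne t h0), length_obs, if_neg]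
    · simp [h0.ne', Action.ofBit]
    · rintro ⟨h3, h⟩
      refine h ((hdrop t h3).2 ?_)
      rw [pingTime] at ht
      -- The latest step before `t` that is congruent to `1` modulo 3.
      exact ⟨t - 1 - (t - 2) % 3, by omega, by omega, by omega, by omega⟩
  · have h5 : 5 ≤ pingTime E := by rw [pingTime]; omega
    rw [pingLeader, if_neg (hne _ (by omega)), length_obs, if_pos]
    refine ⟨by omega, ?_⟩
    rw [hdrop _ (by omega)]
    rintro ⟨n, h1, h2, h3, h4⟩
    rw [pingTime] at *
    omega

theorem firstHeard_ping (hG : G.Connected) {l v : V} {o : ℕ} (hv : G.dist l v = o + 1) (t : ℕ) :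
    firstHeard (obs (pingTrace G l v) (hear G (pingTrace G l) v) t) =
      if o < t then some o else none := by
  have hlt : ∀ n < o, hear G (pingTrace G l) v n = false := by
    intro n hn
    rw [← Bool.not_eq_true, hear_pingTrace_eq_true_iff]
    rintro ⟨w, hw, h⟩
    have := dist_le_succ hG l hw
    rw [pingTrace_eq_true_iff] at h
    omega
  split
  · rename_i h
    rw [firstHeard_eq_some_iff]
    constructor
    · rw [heard_obs _ _ h, Bool.and_eq_true, Bool.not_eq_eq_eq_not, Bool.not_true,
        ← Bool.not_eq_true, pingTrace_eq_true_iff, hear_pingTrace_eq_true_iff]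
      refine ⟨by omega, ?_⟩
      obtain ⟨w, hvw, hw⟩ := exists_adj_dist_eq hG hv
      exact ⟨w, hvw, pingTrace_eq_true_iff.2 (Or.inl hw.symm)⟩
    · intro n hn
      rw [heard_obs _ _ (hn.trans h), hlt n hn]
      simp
  · rename_i h
    rw [firstHeard_eq_none_iff]
    intro n
    rw [heard_obs_eq]
    rcases lt_or_ge n t with hn | hn
    · rw [hlt n (by omega)]
      simp
    · simp [hn]

/-- An acknowledgement moves one layer up per step, so time plus distance is preserved. A node's own
acknowledgement is sent within three steps after its first heard beep has been passed on, whence the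
bound `2 * G.dist l u + 2` for this sum. Again the residues modulo 3 ensure that only beeps of the
next layer are relayed. -/
theorem pingBeeps_obs (hG : G.Connected) {l v : V} {o : ℕ} (hv : G.dist l v = o + 1) {t t' : ℕ}
    (ht : t ≤ t') :
    pingBeeps (obs (pingTrace G l v) (hear G (pingTrace G l) v) t') (o + 1) (t + 1) =
      pingTrace G l v t := by
  rw [Bool.eq_iff_iff, pingTrace_eq_true_iff, hv]
  simp only [pingBeeps, Bool.or_eq_true, Bool.and_eq_true, decide_eq_true_eq]
  rw [Nat.add_right_cancel_iff]
  refine or_congr_right' fun hne => ?_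
  constructor
  · rintro ⟨⟨h1, h2⟩, h3⟩
    refine ⟨by omega, by omega, by omega, ?_⟩
    by_cases h4 : t + 1 ≤ o + 1 + 3
    · exact ⟨v, below_self l v, by omega⟩
    · replace h3 := h3.resolve_left h4
      rw [heard_obs _ _ (by omega), Bool.and_eq_true, hear_pingTrace_eq_true_iff] at h3
      obtain ⟨-, w, hvw, hw⟩ := h3
      have h5 := dist_le_succ hG l hvw
      have h6 := dist_le_succ hG l hvw.symm
      rw [pingTrace_eq_true_iff] at hw
      rcases hw with hw | ⟨-, h7, h8, u, hu, hle⟩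
      · omega
      · exact ⟨u, hu.of_adj hG hvw (by omega), by omega⟩
  · rintro ⟨-, h1, h2, u, hu, hle⟩
    refine ⟨⟨by omega, by omega⟩, ?_⟩
    by_cases h4 : t + 1 ≤ o + 1 + 3
    · exact Or.inl h4
    · right
      have hne : u ≠ v := by
        rintro rfl
        omega
      obtain ⟨w, hvw, hw, hwu⟩ := hu.exists_adj hG hne
      rw [heard_obs _ _ (by omega), Bool.and_eq_true, Bool.not_eq_eq_eq_not, Bool.not_true,
        ← Bool.not_eq_true, pingTrace_eq_true_iff, hear_pingTrace_eq_true_iff]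
      refine ⟨by omega, w, hvw, pingTrace_eq_true_iff.2 (Or.inr ⟨by omega, by omega, by omega, u,
        hwu, by omega⟩)⟩

/-- Acknowledgement beeps have no gaps in their residue class, so three quiet steps in the closed
neighbourhood mean that all acknowledgements have passed. -/
theorem localRun_pingFollow (hG : G.Connected) {l v : V} {E : ℕ} (hE : ∀ v, G.dist l v ≤ E)
    {o : ℕ} (hv : G.dist l v = o + 1) :
    ∃ t ≤ pingTime E + o,
      (∀ u, u = v ∨ G.Adj v u → ∀ n ≥ t, pingTrace G l u n = false) ∧
      LocalRun pingFollow (hear G (pingTrace G l) v) t t (pingTrace G l v) := by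
  set A := pingTrace G l with hA
  have hA' : ∀ u n, A u n = true ↔ n = G.dist l u ∨ (0 < G.dist l u ∧ G.dist l u ≤ n ∧
      (n + 1 + G.dist l u) % 3 = 0 ∧
        ∃ w, Below G l u w ∧ n + G.dist l u ≤ 2 * G.dist l w + 2) :=
    fun u n => pingTrace_eq_true_iff
  have hd : ∀ u, u = v ∨ G.Adj v u →
      G.dist l u = o ∨ G.dist l u = o + 1 ∨ G.dist l u = o + 2 := by
    rintro u (rfl | hu)
    · omega
    · have h1 := dist_le_succ hG l hu
      have h2 := dist_le_succ hG l hu.symm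
      omega
  have hquiet : ∀ t, (o + 4 ≤ (obs (A v) (hear G A v) t).length ∧
      quiet (obs (A v) (hear G A v) t)
        (fun n => pingBeeps (obs (A v) (hear G A v) t) (o + 1) (n + 1)) = true) ↔
      o + 4 ≤ t ∧ ∀ u, u = v ∨ G.Adj v u → ∀ i, 1 ≤ i → i ≤ 3 → A u (t - i) = false := by
    intro t
    rw [quiet_obs fun n hn => pingBeeps_obs hG hv hn.le, length_obs]
    constructor
    · rintro ⟨h4, -, h⟩
      refine ⟨h4, ?_⟩
      rintro u (rfl | hu) i h1 h3
      · exact (h i h1 h3).1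
      · have := (h i h1 h3).2
        simp only [hear, decide_eq_false_iff_not, not_exists, not_and, Bool.not_eq_true] at this
        exact this u hu
    · rintro ⟨h4, h⟩
      refine ⟨h4, by omega, fun i h1 h3 => ⟨h v (Or.inl rfl) i h1 h3, ?_⟩⟩
      simp only [hear, decide_eq_false_iff_not, not_exists, not_and, Bool.not_eq_true]
      exact fun u hu => h u (Or.inr hu) i h1 h3
  have hvE := hE v
  have hex : o + 4 ≤ pingTime E + o ∧ ∀ u, u = v ∨ G.Adj v u → ∀ i, 1 ≤ i → i ≤ 3 →
      A u (pingTime E + o - i) = false := by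
    rw [pingTime]
    refine ⟨by omega, fun u hu i h1 h3 => ?_⟩
    rw [← Bool.not_eq_true, hA']
    have hdu := hd u hu
    have huE := hE u
    rintro (h | ⟨h0, h4, h5, w, -, hw⟩)
    · omega
    · have := hE w
      omega
  have hex' := (hquiet _).2 hex
  have hexists : ∃ t, o + 4 ≤ (obs (A v) (hear G A v) t).length ∧
      quiet (obs (A v) (hear G A v) t)
        (fun n => pingBeeps (obs (A v) (hear G A v) t) (o + 1) (n + 1)) = true := ⟨_, hex'⟩
  classical
  have hfind := (hquiet _).1 (Nat.find_spec hexists)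
  refine ⟨Nat.find hexists, Nat.find_min' hexists hex', ?_, ?_, ?_⟩
  · obtain ⟨h4, h⟩ := hfind
    set t := Nat.find hexists
    intro u hu n hn
    rw [← Bool.not_eq_true, hA']
    have hdu := hd u hu
    rintro (hnu | ⟨hu0, hle, hmod, w, hw, hnw⟩)
    · omega
    obtain ⟨i, hi1, hi3, hi⟩ : ∃ i, 1 ≤ i ∧ i ≤ 3 ∧ (t - i + 1 + G.dist l u) % 3 = 0 :=
      ⟨(t + G.dist l u) % 3 + 1, by omega, by omega, by omega⟩
    -- The node's own relayed first beep in step `o + 1` excludes `t = o + 4`. So the last three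
    -- steps are not earlier than `o + 2`, by which time even a neighbour of the next layer has been
    -- reached.
    have hvt : t - 3 ≠ o + 1 := by
      intro heq
      have := h v (Or.inl rfl) 3 (by omega) le_rfl
      rw [← Bool.not_eq_true, hA', hv] at this
      exact this (Or.inl heq)
    have := h u hu i hi1 hi3
    rw [← Bool.not_eq_true, hA'] at this
    exact this (Or.inr ⟨hu0, by omega, hi, w, hw, by omega⟩)
  · intro t ht
    rw [pingFollow, firstHeard_ping hG hv]
    rcases lt_or_ge o t with hot | hot
    · simp only [hot, if_true]
      rw [if_neg (Nat.find_min hexists ht), length_obs, pingBeeps_obs hG hv le_rfl]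
    · simp only [not_lt.2 hot, if_false]
      have : A v t = false := by
        rw [← Bool.not_eq_true, hA', hv]
        omega
      rw [this]
      rfl
  · rw [pingFollow, firstHeard_ping hG hv]
    have hot : o < Nat.find hexists := by omega
    simp only [hot, if_true]
    rw [if_pos (Nat.find_spec hexists), length_obs]

theorem netRun_estimateDiameter (hG : G.Connected) {l : V} {lead : V → Bool}
    (hl : ∀ v, lead v = true ↔ v = l) {E D : ℕ} (hE : ∀ v, G.dist l v ≤ E)
    (hex : ∃ v, G.dist l v = E) (hE1 : 1 ≤ E) (hD : D = pingTime E + 1) :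
    NetRun G (fun v => estimateDiameter (lead v))
      (pingTime E + (3 * (2 * D.size + 4) + D)) fun _ => D := by
  subst hD
  set D := pingTime E + 1 with hD
  set c := toBits D.size D with hc
  have hclen : (encode c).length = 2 * D.size + 4 := by rw [length_encode, hc, length_toBits]
  refine ⟨thenWave G (pingTrace G l) l c (pingTime E), fun v => ?_⟩
  have h5 : 5 ≤ pingTime E := by rw [pingTime]; omega
  by_cases hv : lead v = true
  · obtain rfl := (hl v).1 hv
    simp only [estimateDiameter, hv, if_true]
    have := localRun_bind_waveSend (l := v) (s := c) (τ := pingTime E) (fun n hn => by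
        rw [← Bool.not_eq_true, pingTrace_eq_true_iff, SimpleGraph.dist_self]
        omega)
      (localRun_pingLeader hG hE hex hE1) (fun i => 3 * (encode (toBits i.size i)).length + i)
      (fun i => toBits i.size i) rfl
    rw [← hD, ← hc, hclen] at this
    exact this
  · simp only [estimateDiameter, hv]
    have hne : l ≠ v := fun h => hv ((hl v).2 h.symm)
    obtain ⟨o, ho⟩ := Nat.exists_eq_succ_of_ne_zero (hG.pos_dist_of_ne hne).ne'
    have hEv := hE v
    have hEt : E ≤ pingTime E := by rw [pingTime]; omega
    obtain ⟨t, ht, hsil, hrun⟩ := localRun_pingFollow hG hE ho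
    have hdur : t + (ofBits c - 1 + 3 * (encode c).length + ofBits c - t) =
        pingTime E + (3 * (2 * D.size + 4) + D) := by
      rw [hc, ofBits_toBits_size, ← hc, hclen]
      omega
    have := localRun_bind_waveFollow (s := c) (τ := pingTime E) hG ho ht hsil hrun
      (fun t s => ofBits s - 1 + 3 * (encode s).length + ofBits s - t)
      (by rw [hclen] at *; omega)
    rw [hdur, hc, ofBits_toBits_size] at this
    exact this

end Diameter

/-! ### Concurrent binary searches -/

theorem prefixString_some (known : List ℕ) (own : ℕ) :
    prefixString known (some own) =
      (known.flatMap fun x => [2 * x, 2 * x + 1]).map fun y => decide (own = y) := by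
  simp [prefixString, List.map_flatMap]

theorem filter_zip_map (l : List ℕ) (f : ℕ → Bool) :
    ((l.zip (l.map f)).filter Prod.snd).map Prod.fst = l.filter f := by
  induction l with
  | nil => rfl
  | cons x l ih => cases h : f x <;> simp [h, ih]

/-- `known` lists without repetition what remains of the strings `own` if the last `n` bits are
deleted. -/
structure IsPrefixList {V : Type} (own : V → Option ℕ) (n : ℕ) (known : List ℕ) : Prop where
  nodup : known.Nodup
  mem : ∀ y, y ∈ known ↔ ∃ v x, own v = some x ∧ y = x / 2 ^ n

open Classical in
/-- The list of prefixes that are known after a round of the searches. -/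
noncomputable def nextPrefixes {V : Type} (own : V → Option ℕ) (n : ℕ) (known : List ℕ) :
    List ℕ :=
  (known.flatMap fun x => [2 * x, 2 * x + 1]).filter
    fun y => decide (∃ v, (own v).map (· / 2 ^ n) = some y)

namespace IsPrefixList

variable {V : Type} {own : V → Option ℕ} {n : ℕ} {known : List ℕ}

/-- Each prefix is one of the two extensions of its own prefix, and different prefixes have disjoint
sets of extensions. -/
theorem next (h : IsPrefixList own (n + 1) known) :
    IsPrefixList own n (nextPrefixes own n known) := by
  constructor
  · refine List.Nodup.filter _ ?_
    rw [List.nodup_flatMap]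
    refine ⟨fun x _ => by simp, h.nodup.imp fun {a b} hab => ?_⟩
    simp [Function.onFun, List.disjoint_left]
    omega
  · intro y
    simp only [nextPrefixes, List.mem_filter, decide_eq_true_eq, List.mem_flatMap,
      Option.map_eq_some_iff]
    constructor
    · rintro ⟨-, v, x, hx, rfl⟩
      exact ⟨v, x, hx, rfl⟩
    · rintro ⟨v, x, hx, rfl⟩
      refine ⟨⟨x / 2 ^ (n + 1), (h.mem _).2 ⟨v, x, hx, rfl⟩, ?_⟩, v, x, hx, rfl⟩
      rw [pow_succ, ← Nat.div_div_eq_div_mul]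
      simp
      omega

theorem length_le_card [Fintype V] (h : IsPrefixList own n known) {k : ℕ}
    (hk : k = Set.ncard {v | own v ≠ none}) : known.length ≤ k := by
  classical
  rw [← List.toFinset_card_of_nodup h.nodup, ← Set.ncard_coe_finset, hk]
  have hsub : (↑known.toFinset : Set ℕ) ⊆
      (fun v => (own v).elim 0 (· / 2 ^ n)) '' {v | own v ≠ none} := by
    intro y hy
    simp only [List.coe_toFinset, Set.mem_ofPred_eq] at hy
    obtain ⟨v, x, hx, rfl⟩ := (h.mem y).1 hy
    exact ⟨v, by simp [hx], by simp [hx]⟩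
  exact (Set.ncard_le_ncard hsub (Set.toFinite _)).trans (Set.ncard_image_le (Set.toFinite _))

theorem length_le_two_pow (h : IsPrefixList own n known) {P : ℕ}
    (hP : ∀ v x, own v = some x → x < 2 ^ P) (hn : n ≤ P) : known.length ≤ 2 ^ (P - n) := by
  rw [← List.toFinset_card_of_nodup h.nodup, ← Finset.card_range (2 ^ (P - n))]
  refine Finset.card_le_card fun y hy => ?_
  rw [List.mem_toFinset] at hy
  obtain ⟨v, x, hx, rfl⟩ := (h.mem y).1 hy
  rw [Finset.mem_range]
  refine Nat.div_lt_of_lt_mul ((hP v x hx).trans_eq ?_)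
  rw [← pow_add]
  congr 1
  omega

theorem zero {P : ℕ} (hP : ∀ v x, own v = some x → x < 2 ^ P) (hex : ∃ v, own v ≠ none) :
    IsPrefixList own P [0] := by
  refine ⟨by simp, fun y => ?_⟩
  simp only [List.mem_singleton]
  constructor
  · rintro rfl
    obtain ⟨v, hv⟩ := hex
    obtain ⟨x, hx⟩ := Option.ne_none_iff_exists'.1 hv
    exact ⟨v, x, hx, (Nat.div_eq_of_lt (hP v x hx)).symm⟩
  · rintro ⟨v, x, hx, rfl⟩
    exact Nat.div_eq_of_lt (hP v x hx)

end IsPrefixList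

section SearchRuns

variable {V : Type} [Fintype V] {G : SimpleGraph V} [DecidableRel G.Adj]

theorem superposition_prefixString (own : V → Option ℕ) (known : List ℕ) :
    extendPrefixes known (superposition (fun v => prefixString known (own v)) (2 * known.length)) =
      (known.flatMap fun x => [2 * x, 2 * x + 1]).filter
        fun y => @decide (∃ v, own v = some y) (Classical.propDecidable _) := by
  classical
  rw [extendPrefixes, ← filter_zip_map]
  congr 3
  refine List.ext_getElem (by simp [superposition, mul_comm]) fun i h₁ h₂ => ?_
  simp only [superposition, List.getElem_map, List.getElem_range]
  rw [Bool.eq_iff_iff]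
  simp only [decide_eq_true_eq]
  refine exists_congr fun u => ?_
  simp only [List.length_map] at h₂
  cases h : own u with
  | none => simp [prefixString, heard]
  | some x =>
    rw [prefixString_some, heard, List.getD_eq_getElem _ _ (by simpa using h₂)]
    simp

theorem length_superposition (s : V → List Bool) (p : ℕ) : (superposition s p).length = p := by
  simp [superposition]

theorem netRun_searchRound (hG : G.Connected) {l : V} {lead : V → Bool}
    (hl : ∀ v, lead v = true ↔ v = l) {D : ℕ} (hD1 : 1 ≤ D) (hD : ∀ v, G.dist l v ≤ D)
    (own : V → Option ℕ) (n : ℕ) (known : List ℕ) :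
    NetRun G (fun v => searchRound D (lead v) ((own v).map (· / 2 ^ n)) known)
      (30 + 3 * D + 18 * known.length) fun _ => nextPrefixes own n known := by
  obtain ⟨out, hrun, hout⟩ := netRun_collectMessages hG hl hD1 hD
    (fun v => prefixString known ((own v).map (· / 2 ^ n))) (2 * known.length)
  have hwave := netRun_beepWave hG hl hD out
  rw [hout, length_encode, length_superposition] at hwave
  have := hrun.bind (f := fun v Z => do
      let r ← beepWave D (lead v) Z
      pure (extendPrefixes known r.2))
    (hwave.map fun v r => extendPrefixes known r.2)
  rw [show 18 + D + (3 * (2 * known.length) + D) + (3 * (2 * (2 * known.length) + 4) + D) =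
    30 + 3 * D + 18 * known.length by ring] at this
  have hnext := superposition_prefixString (fun v => (own v).map (· / 2 ^ n)) known
  exact (funext fun _ => hnext : (fun _ : V => _) = fun _ => nextPrefixes own n known) ▸ this

/-- Prefixes never outnumber sources, so an abort certifies `cap < k`. Rounds take place only while
there are at most `cap` prefixes, which bounds each of them independently of `k`. -/
theorem netRun_searchUntil (hG : G.Connected) {l : V} {lead : V → Bool}
    (hl : ∀ v, lead v = true ↔ v = l) {D : ℕ} (hD1 : 1 ≤ D) (hD : ∀ v, G.dist l v ≤ D)
    (cap : ℕ) {own : V → Option ℕ} {k : ℕ} (hk : k = Set.ncard {v | own v ≠ none}) (n : ℕ)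
    {known : List ℕ} (hknown : IsPrefixList own n known) :
    ∃ T ≤ n * (30 + 3 * D + 18 * cap), ∃ out : Option (List ℕ),
      NetRun G (fun v => searchUntil cap D (lead v) (own v) n known) T (fun _ => out) ∧
      (out = none ∧ cap < k ∨ ∃ ids, out = some ids ∧ IsPrefixList own 0 ids ∧
        ids.length ≤ cap) := by
  induction n generalizing known with
  | zero =>
    refine ⟨0, by simp, _, NetRun.pure _, ?_⟩
    have := hknown.length_le_card hk
    by_cases h : cap < known.length
    · exact Or.inl ⟨if_pos h, by omega⟩
    · exact Or.inr ⟨known, if_neg h, hknown, by omega⟩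
  | succ n ih =>
    by_cases h : cap < known.length
    · have := hknown.length_le_card hk
      refine ⟨0, by simp, none, ?_, Or.inl ⟨rfl, by omega⟩⟩
      simp only [searchUntil, h, if_true]
      exact NetRun.pure _
    · obtain ⟨T, hT, out, hrun, hout⟩ := ih hknown.next
      refine ⟨30 + 3 * D + 18 * known.length + T, ?_, out, ?_, hout⟩
      · rw [Nat.succ_mul n]
        omega
      · simp only [searchUntil, h, if_false]
        exact (netRun_searchRound hG hl hD1 hD own n known).bind
          (f := fun v known' => searchUntil cap D (lead v) (own v) n known') hrun

/-- The summand with index `i` is the round that leaves `i` bits to be searched. It starts from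
prefixes of `P - 1 - i` bits, of which there are at most `2 ^ (P - 1 - i)` and at most `k`. -/
theorem netRun_search (hG : G.Connected) {l : V} {lead : V → Bool}
    (hl : ∀ v, lead v = true ↔ v = l) {D : ℕ} (hD1 : 1 ≤ D) (hD : ∀ v, G.dist l v ≤ D)
    {own : V → Option ℕ} {k : ℕ} (hk : k = Set.ncard {v | own v ≠ none}) {P : ℕ}
    (hP : ∀ v x, own v = some x → x < 2 ^ P) (n : ℕ) (hn : n ≤ P)
    {known : List ℕ} (hknown : IsPrefixList own n known) :
    ∃ T ≤ ∑ i ∈ Finset.range n, (30 + 3 * D + 18 * min (2 ^ (P - 1 - i)) k), ∃ out : List ℕ,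
      NetRun G (fun v => search D (lead v) (own v) n known) T (fun _ => out) ∧
      IsPrefixList own 0 out := by
  induction n generalizing known with
  | zero => exact ⟨0, by simp, known, NetRun.pure _, hknown⟩
  | succ n ih =>
    obtain ⟨T, hT, out, hrun, hout⟩ := ih (by omega) hknown.next
    refine ⟨30 + 3 * D + 18 * known.length + T, ?_, out, ?_, hout⟩
    · have h1 := hknown.length_le_card hk
      have h2 := hknown.length_le_two_pow hP hn
      rw [show P - (n + 1) = P - 1 - n by omega] at h2
      have h3 := le_min h2 h1
      rw [Finset.sum_range_succ]
      omega
    · exact (netRun_searchRound hG hl hD1 hD own n known).bind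
        (f := fun v known' => search D (lead v) (own v) n known') hrun

/-! ### Message blocks -/

theorem heard_append_left {s t : List Bool} {i : ℕ} (h : i < s.length) :
    heard (s ++ t) i = heard s i := by
  simp [heard, List.getElem?_append_left h]

theorem heard_append_right (s t : List Bool) (i : ℕ) : heard (s ++ t) (s.length + i) = heard t i := by
  simp [heard, List.getElem?_append_right]

theorem heard_flatMap (f : ℕ → List Bool) {p : ℕ} (hf : ∀ x, (f x).length = p) (ids : List ℕ)
    {j r : ℕ} (hj : j < ids.length) (hr : r < p) :
    heard (ids.flatMap f) (j * p + r) = heard (f ids[j]) r := by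
  induction ids generalizing j with
  | nil => simp at hj
  | cons x ids ih =>
    rw [List.flatMap_cons]
    cases j with
    | zero =>
      rw [heard_append_left (by rw [hf]; omega)]
      simp
    | succ j =>
      rw [show (j + 1) * p + r = (f x).length + (j * p + r) by rw [hf]; ring, heard_append_right,
        ih (by simpa using hj)]
      simp

theorem take_drop_superposition (s : V → List Bool) {N a p : ℕ} (h : a + p ≤ N) :
    ((superposition s N).drop a).take p =
      (List.range p).map fun r => @decide (∃ u, heard (s u) (a + r) = true)
        (Classical.propDecidable _) := by
  refine List.ext_getElem (by simp [superposition]; omega) fun i h₁ h₂ => ?_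
  simp [superposition]

/-- By injectivity only one node writes ones into a given block, so the bitwise OR does not mix
messages. -/
theorem readBlocks_superposition {ident : V → ℕ} (hinj : Function.Injective ident)
    {msg : V → Option ℕ} {p : ℕ} (hp : ∀ v m, msg v = some m → m < 2 ^ p) {ids : List ℕ}
    (hids : ∀ y, y ∈ ids ↔ ∃ v, msg v ≠ none ∧ ident v = y) (m : ℕ) :
    m ∈ (readBlocks ids p (superposition (fun v => messageString ids p (ident v) (msg v))
      (ids.length * p))).map Prod.snd ↔ ∃ u, msg u = some m := by
  set sup := superposition (fun v => messageString ids p (ident v) (msg v)) (ids.length * p)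
    with hsup
  have hblock : ∀ j (hj : j < ids.length) u x, ident u = ids[j] → msg u = some x →
      ofBits ((sup.drop (j * p)).take p) = x := by
    intro j hj u x hu hx
    have hle : j * p + p ≤ ids.length * p := by
      rw [← Nat.succ_mul]
      exact Nat.mul_le_mul_right _ hj
    rw [hsup, take_drop_superposition _ hle]
    convert ofBits_toBits (hp u x hx) using 2
    refine List.map_congr_left fun r hr => ?_
    rw [List.mem_range] at hr
    have hheard : ∀ w y, msg w = some y →
        (heard (messageString ids p (ident w) (msg w)) (j * p + r) =
          heard (if ids[j] = ident w then toBits p y else List.replicate p false) r) := by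
      intro w y hy
      rw [hy, messageString]
      refine heard_flatMap (fun x => if x = ident w then toBits p y else List.replicate p false)
        (fun x => ?_) ids hj hr
      split <;> simp
    have htb : heard (toBits p x) r = x.testBit (p - 1 - r) := by
      simp [heard, toBits, hr]
    rw [← htb, Bool.eq_iff_iff]
    simp only [decide_eq_true_eq]
    constructor
    · rintro ⟨w, hw⟩
      cases hy : msg w with
      | none => simp [hy, messageString, heard] at hw
      | some y =>
        rw [hheard w y hy] at hw
        split at hw
        · rename_i h
          obtain rfl := hinj (hu.trans h)
          rw [hx] at hy
          rwa [Option.some_injective _ hy]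
        · simp [heard, hr] at hw
    · intro h
      exact ⟨u, by rw [hheard u x hx, if_pos hu.symm, h]⟩
  simp only [readBlocks, List.map_map, List.mem_map, Function.comp_apply]
  constructor
  · rintro ⟨⟨y, j⟩, hyj, rfl⟩
    rw [List.mem_zipIdx_iff_getElem?, List.getElem?_eq_some_iff] at hyj
    obtain ⟨hj, hy⟩ := hyj
    obtain ⟨u, hu, huy⟩ := (hids ids[j]).1 (List.getElem_mem hj)
    obtain ⟨x, hx⟩ := Option.ne_none_iff_exists'.1 hu
    exact ⟨u, by rw [hx, hblock j hj u x huy hx]⟩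
  · rintro ⟨u, hu⟩
    obtain ⟨j, hj, hju⟩ := List.getElem_of_mem ((hids (ident u)).2 ⟨u, by simp [hu], rfl⟩)
    refine ⟨(ident u, j), ?_, hblock j hj u m hju.symm hu⟩
    rw [List.mem_zipIdx_iff_getElem?, List.getElem?_eq_some_iff]
    exact ⟨hj, hju⟩

end SearchRuns

/-! ### The complete algorithm. -/

section MultiBroadcast

variable {V : Type} [Fintype V] {G : SimpleGraph V} [DecidableRel G.Adj]

theorem netRun_withProvenanceUntil (hG : G.Connected) {ident : V → ℕ}
    (hinj : Function.Injective ident) {l : V} {lead : V → Bool}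
    (hl : ∀ v, lead v = true ↔ v = l) {D : ℕ} (hD1 : 1 ≤ D) (hD : ∀ v, G.dist l v ≤ D)
    {msg : V → Option ℕ} {p k top : ℕ} (hp : ∀ v m, msg v = some m → m < 2 ^ p)
    (hk : k = Set.ncard {v | msg v ≠ none}) (hex : ∃ v, msg v ≠ none)
    (htop : ∀ v, ident v ≤ top) :
    ∃ T ≤ top.size * (30 + 3 * D + 18 * D) + (30 + 3 * D + 9 * (min D k * p)),
      ∃ out : Option (List (ℕ × ℕ)),
        NetRun G (fun v => withProvenanceUntil ⟨lead v, top, D, p⟩ (ident v) (msg v)) T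
          (fun _ => out) ∧
        (out = none ∧ D < k ∨ ∃ pairs, out = some pairs ∧
          ∀ m, m ∈ pairs.map Prod.snd ↔ ∃ u, msg u = some m) := by
  set own : V → Option ℕ := fun v => (msg v).map fun _ => ident v with hown
  have hne : ∀ v, own v ≠ none ↔ msg v ≠ none := fun v => by simp [hown]
  have hk' : k = Set.ncard {v | own v ≠ none} := by simp only [hne, hk]
  have hinit : IsPrefixList own top.size [0] := by
    refine IsPrefixList.zero (fun v x hx => ?_) (by simpa only [hne] using hex)
    obtain ⟨_, -, rfl⟩ := Option.map_eq_some_iff.1 hx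
    exact (htop v).trans_lt (Nat.lt_size_self top)
  obtain ⟨T, hT, out, hrun, hout⟩ := netRun_searchUntil hG hl hD1 hD D hk' top.size hinit
  rcases hout with ⟨rfl, hDk⟩ | ⟨ids, rfl, hids, hcap⟩
  · have hall := hrun.bind (T₂ := 0) (b := fun _ => (none : Option (List (ℕ × ℕ))))
      (f := fun v found => match found with
      | none => pure none
      | some ids => do
        let m ← collectMessages D (lead v) (messageString ids p (ident v) (msg v)) (ids.length * p)
        let r ← beepWave D (lead v) m
        pure (some (readBlocks ids p r.2))) (NetRun.pure _)
    exact ⟨T, by omega, none, hall, Or.inl ⟨rfl, hDk⟩⟩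
  · obtain ⟨Z, hcollect, hZ⟩ := netRun_collectMessages hG hl hD1 hD
      (fun v => messageString ids p (ident v) (msg v)) (ids.length * p)
    have hwave := netRun_beepWave hG hl hD Z
    rw [hZ, length_encode, length_superposition] at hwave
    have hrest := hcollect.bind (f := fun v m => do
      let r ← beepWave D (lead v) m
      pure (some (readBlocks ids p r.2))) (hwave.map fun v r => some (readBlocks ids p r.2))
    have hall := hrun.bind (f := fun v found => match found with
      | none => pure none
      | some ids => do
        let m ← collectMessages D (lead v) (messageString ids p (ident v) (msg v)) (ids.length * p)
        let r ← beepWave D (lead v) m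
        pure (some (readBlocks ids p r.2))) hrest
    refine ⟨_, ?_, some (readBlocks ids p (superposition
      (fun v => messageString ids p (ident v) (msg v)) (ids.length * p))), hall, Or.inr ⟨_, rfl, fun m => ?_⟩⟩
    · have : ids.length * p ≤ min D k * p :=
        Nat.mul_le_mul_right _ (le_min hcap (hids.length_le_card hk'))
      omega
    · refine readBlocks_superposition hinj hp (fun y => (hids.mem y).trans ?_) m
      constructor
      · rintro ⟨v, x, hx, rfl⟩
        obtain ⟨m, hm, rfl⟩ := Option.map_eq_some_iff.1 hx
        exact ⟨v, by simp [hm], by simp⟩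
      · rintro ⟨v, hv, rfl⟩
        obtain ⟨m, hm⟩ := Option.ne_none_iff_exists'.1 hv
        exact ⟨v, ident v, by simp [hown, hm], by simp⟩

/-- Up to depth `log₂ k` the counts grow geometrically and sum to at most `2 * k`; every further
depth contributes at most `k`. -/
theorem sum_min_two_pow_le {k : ℕ} (hk : 1 ≤ k) (p : ℕ) :
    ∑ i ∈ Finset.range p, min (2 ^ i) k ≤ 2 * k + k * (p - (Nat.log 2 k + 1)) := by
  set q := Nat.log 2 k + 1 with hq
  have hkey : ∑ i ∈ Finset.range p, min (2 ^ i) k + 1 ≤ 2 ^ min p q + k * (p - q) := by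
    induction p with
    | zero => simp
    | succ p ih =>
      rw [Finset.sum_range_succ]
      rcases lt_or_ge p q with h | h
      · have h1 := min_le_left (2 ^ p) k
        rw [min_eq_left h.le, Nat.sub_eq_zero_of_le h.le] at ih
        rw [min_eq_left (Nat.succ_le_of_lt h), Nat.sub_eq_zero_of_le (Nat.succ_le_of_lt h), pow_succ]
        omega
      · have h1 := min_le_right (2 ^ p) k
        rw [min_eq_right h] at ih
        rw [min_eq_right (show q ≤ p + 1 by omega), Nat.succ_sub h, Nat.mul_succ]
        omega
  have h1 : 2 ^ min p q ≤ 2 * k := by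
    refine (Nat.pow_le_pow_right two_pos (min_le_right p q)).trans ?_
    rw [hq, pow_succ, mul_comm]
    exact Nat.mul_le_mul_left _ (Nat.pow_log_le_self 2 (by omega))
  omega

/-- The multi-broadcast algorithm is correct, and its duration is bounded in terms of the diameter
estimate `D` and the largest message length `p`. -/
theorem netRun_multiBroadcast [Nontrivial V] (hG : G.Connected) {ident : V → ℕ}
    (hinj : Function.Injective ident) {msg : V → Option ℕ} {k Te : ℕ}
    (hk : k = Set.ncard {v | msg v ≠ none}) (hex : ∃ v, msg v ≠ none)
    (helect : NetRun G (fun v => elect (ident v)) Te fun _ => Finset.univ.sup ident) :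
    ∃ D p S T : ℕ, ∃ out : Finset ℕ, 1 ≤ D ∧ D ≤ 8 * G.diam ∧
      S = (Finset.univ.sup ident).size ∧ (∃ v, p = (msg v).elim 0 Nat.size) ∧
      T ≤ Te + 89 * D + 9 * p + 51 * (S * D) + 9 * (min D k * p) +
        (if D < k then 33 * (p * D) + 18 * ∑ i ∈ Finset.range p, min (2 ^ i) k else 0) ∧
      NetRun G (fun v => multiBroadcast elect (ident v) (msg v)) T (fun _ => out) ∧
      ∀ m, m ∈ out ↔ ∃ u, msg u = some m := by
  set top := Finset.univ.sup ident with htop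
  obtain ⟨l, hlt⟩ := exists_ident_eq_sup ident
  rw [← htop] at hlt
  have hl : ∀ v, (ident v == top) = true ↔ v = l := fun v => by
    rw [beq_iff_eq, ← hlt]
    exact hinj.eq_iff
  set E := Finset.univ.sup (G.dist l) with hE
  have hEle : ∀ v, G.dist l v ≤ E := fun v => Finset.le_sup (f := G.dist l) (Finset.mem_univ v)
  have hEex : ∃ v, G.dist l v = E := exists_ident_eq_sup (G.dist l)
  have hE1 : 1 ≤ E := by
    obtain ⟨v, hv⟩ := exists_ne l
    exact (hG.pos_dist_of_ne hv.symm).trans_le (hEle v)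
  have hEdiam : E ≤ G.diam := by
    obtain ⟨v, hv⟩ := hEex
    exact hv ▸ dist_le_diam_of_connected hG l v
  set D := pingTime E + 1 with hD
  -- Hence `D ≤ 2 * E + 6 ≤ 8 * E`, the source of the factor `8`.
  have hD' : D = 2 * E + 5 - 2 * E % 3 + 1 := rfl
  have hD1 : 1 ≤ D := by omega
  have hDE : ∀ v, G.dist l v ≤ D := fun v => (hEle v).trans (by omega)
  set len : V → ℕ := fun v => (msg v).elim 0 Nat.size with hlen
  set p := Finset.univ.sup len with hp
  have hlenle : ∀ v, len v ≤ p := fun v => Finset.le_sup (f := len) (Finset.mem_univ v)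
  have hlenex : ∃ v, len v = p := exists_ident_eq_sup len
  have hmsg : ∀ v m, msg v = some m → m < 2 ^ p := fun v m hm => by
    have := hlenle v
    simp only [hlen, hm, Option.elim_some] at this
    exact Nat.size_le.1 this
  have hsetup := helect.bind (f := fun v top => do
      let D ← estimateDiameter (ident v == top)
      let p ← getMessageLength D (ident v == top) ((msg v).elim 0 Nat.size)
      pure (⟨ident v == top, top, D, p⟩ : Setup))
    ((netRun_estimateDiameter hG hl hEle hEex hE1 hD).bind (f := fun v D => do
      let p ← getMessageLength D (ident v == top) ((msg v).elim 0 Nat.size)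
      pure (⟨ident v == top, top, D, p⟩ : Setup))
    ((netRun_getMessageLength hG hl hD1 hDE len hlenle hlenex).map
      fun v p => (⟨ident v == top, top, D, p⟩ : Setup)))
  obtain ⟨T₁, hT₁, res, hrun₁, hres⟩ := netRun_withProvenanceUntil hG hinj hl hD1 hDE hmsg hk hex
    (top := top) fun v => Finset.le_sup (f := ident) (Finset.mem_univ v)
  -- Logarithmic terms are bounded linearly and constants by multiples of `D`: estimation and length
  -- determination take at most `56 * D + 9 * p`, and the fixed part of the block transmission `33 *
  -- D`.
  have hsizeD : D.size ≤ D := Nat.size_le.2 D.lt_two_pow_self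
  have hsizep : p.size ≤ p := Nat.size_le.2 p.lt_two_pow_self
  have hSD : top.size * (30 + 3 * D + 18 * D) ≤ 51 * (top.size * D) := by
    calc top.size * (30 + 3 * D + 18 * D) ≤ top.size * (51 * D) :=
          Nat.mul_le_mul_left _ (by omega)
      _ = _ := by ring
  rcases hres with ⟨rfl, hDk⟩ | ⟨pairs, rfl, hpairs⟩
  · obtain ⟨T₂, hT₂, msgs, hrun₂, hmsgs⟩ := netRun_search hG hl hD1 hDE hk hmsg p le_rfl
      (IsPrefixList.zero hmsg hex)
    have hsum : ∑ i ∈ Finset.range p, (30 + 3 * D + 18 * min (2 ^ (p - 1 - i)) k) =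
        p * (30 + 3 * D) + 18 * ∑ i ∈ Finset.range p, min (2 ^ i) k := by
      rw [Finset.sum_add_distrib, Finset.sum_const, Finset.card_range, smul_eq_mul,
        ← Finset.mul_sum, Finset.sum_range_reflect (fun i => min (2 ^ i) k)]
    have hpD : p * (30 + 3 * D) ≤ 33 * (p * D) := by
      calc p * (30 + 3 * D) ≤ p * (33 * D) := Nat.mul_le_mul_left _ (by omega)
        _ = _ := by ring
    refine ⟨D, p, _, _, msgs.toFinset, hD1, by omega, rfl, hlenex.imp fun v hv => hv.symm, ?_,
      hsetup.bind (f := fun v S => do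
        let result ← withProvenanceUntil S (ident v) (msg v)
        match result with
        | some pairs => pure (pairs.map Prod.snd).toFinset
        | none => do
          let msgs ← search S.D S.lead (msg v) S.p [0]
          pure msgs.toFinset)
        (hrun₁.bind (f := fun v result => match result with
          | some pairs => pure (pairs.map Prod.snd).toFinset
          | none => do
            let msgs ← search D (ident v == top) (msg v) p [0]
            pure msgs.toFinset)
          (hrun₂.map fun _ msgs => msgs.toFinset)), fun m => ?_⟩
    · rw [if_pos hDk]
      omega
    · rw [List.mem_toFinset, hmsgs.mem]
      simp
  · refine ⟨D, p, _, _, (pairs.map Prod.snd).toFinset, hD1, by omega, rfl,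
      hlenex.imp fun v hv => hv.symm, ?_,
      hsetup.bind (f := fun v S => do
        let result ← withProvenanceUntil S (ident v) (msg v)
        match result with
        | some pairs => pure (pairs.map Prod.snd).toFinset
        | none => do
          let msgs ← search S.D S.lead (msg v) S.p [0]
          pure msgs.toFinset)
        (hrun₁.bind (f := fun v result => match result with
          | some pairs => pure (pairs.map Prod.snd).toFinset
          | none => do
            let msgs ← search D (ident v == top) (msg v) p [0]
            pure msgs.toFinset)
          (NetRun.pure _)), fun m => ?_⟩
    · omega
    · rw [List.mem_toFinset]
      exact hpairs m

end MultiBroadcast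

end BeepModel

/-! ### The running time in terms of `k`, `M`, `L` and the diameter. -/

theorem mainTheorem2 :
    ∃ elect : ℕ → BeepModel.Protocol ℕ, BeepModel.ElectsLeader elect ∧
      ∃ C : ℝ, ∀ (V : Type) [Fintype V] [Nontrivial V] (G : SimpleGraph V) [DecidableRel G.Adj]
        (ident : V → ℕ) (msg : V → Option ℕ) (L M k : ℕ),
        G.Connected → Function.Injective ident → (∀ v, ident v < L) →
        (∀ v m, msg v = some m → m < M) →
        k = Set.ncard {v | msg v ≠ none} → 1 ≤ k →
        ∃ T : ℕ,
          (∀ v, ∃ out : Finset ℕ,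
            BeepModel.OutputsWithin G
              (fun u => BeepModel.multiBroadcast elect (ident u) (msg u)) T v out ∧
            (out : Set ℕ) = {m | ∃ u, msg u = some m}) ∧
          (k < M → (T : ℝ) ≤
            C * ((k : ℝ) * (⌈Real.logb 2 ((M : ℝ) / (k : ℝ))⌉ : ℝ) + G.diam * Real.logb 2 L)) ∧
          (M ≤ k → (T : ℝ) ≤ C * ((M : ℝ) + G.diam * Real.logb 2 L)) := by
  refine ⟨BeepModel.elect, BeepModel.electsLeader_elect, 3000, ?_⟩
  intro V _ _ G _ ident msg L M k hG hinj hL hM hk hk1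
  have hex : ∃ v, msg v ≠ none := by
    by_contra! h
    simp [h] at hk
    omega
  obtain ⟨Te, hTe, helect⟩ := BeepModel.exists_netRun_elect hG hinj hL
  obtain ⟨D, p, S, T, out, hD1, hD, hS, ⟨vp, hp⟩, hT, hrun, hout⟩ :=
    BeepModel.netRun_multiBroadcast hG hinj hk hex helect
  refine ⟨T, fun v => ⟨out, (hrun.outputsAt v).1, by ext m; simp [hout]⟩, ?_⟩
  have hlog := BeepModel.one_le_logb_of_injective hinj hL
  have hdiam := BeepModel.one_le_diam hG
  have hM1 : 1 ≤ M := by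
    obtain ⟨v, hv⟩ := hex
    obtain ⟨m, hm⟩ := Option.ne_none_iff_exists'.1 hv
    exact Nat.one_le_of_lt (hM v m hm)
  have hsizeS : (S : ℝ) ≤ Real.logb 2 L + 1 := by
    obtain ⟨w, hw⟩ := BeepModel.exists_ident_eq_sup ident
    rw [hS, ← hw]
    exact BeepModel.size_le_logb_add_one (Nat.one_le_of_lt (hL w)) (hL w)
  obtain ⟨m, hmM, hpm⟩ : ∃ m < M, p = m.size := by
    cases hv : msg vp with
    | none => exact ⟨0, hM1, by simp [hp, hv]⟩
    | some m => exact ⟨m, hM vp m hv, by simp [hp, hv]⟩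
  have hpM : (p : ℝ) ≤ Real.logb 2 M + 1 := by
    rw [hpm]
    exact BeepModel.size_le_logb_add_one hM1 hmM
  -- The sources have distinct identifiers below `L`; this lets `log₂ k` be charged to `log₂ L`.
  have hkL : k ≤ L := by
    rw [hk]
    calc Set.ncard {v | msg v ≠ none} ≤ Nat.card V := Set.ncard_le_card _
      _ = Fintype.card V := Nat.card_eq_fintype_card
      _ ≤ Fintype.card (Fin L) :=
        Fintype.card_le_of_injective (fun v => (⟨ident v, hL v⟩ : Fin L))
          fun a b hab => hinj (by simpa using hab)
      _ = L := Fintype.card_fin L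
  have hkpos : (0 : ℝ) < k := by exact_mod_cast hk1
  have hMpos : (0 : ℝ) < M := by exact_mod_cast hM1
  have hlogk : Real.logb 2 k ≤ Real.logb 2 L :=
    Real.logb_le_logb_of_le (by norm_num) hkpos (by exact_mod_cast hkL)
  set lam := Real.logb 2 L with hlam
  have hdiamR : (1 : ℝ) ≤ G.diam := by exact_mod_cast hdiam
  have hDR : (D : ℝ) ≤ 8 * G.diam := by exact_mod_cast hD
  have hDlam : (D : ℝ) * lam ≤ 8 * (G.diam * lam) := by
    rw [← mul_assoc]
    gcongr
  have hDD : (D : ℝ) ≤ D * lam := le_mul_of_one_le_right (by positivity) hlog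
  have hlamD : lam ≤ G.diam * lam := le_mul_of_one_le_left (by linarith) hdiamR
  have hSD : (S : ℝ) * D ≤ 2 * (D * lam) := by
    calc (S : ℝ) * D ≤ (2 * lam) * D := by gcongr; linarith
      _ = _ := by ring
  have hTR : (T : ℝ) ≤ Te + 89 * D + 9 * p + 51 * (S * D) + 9 * (min (D : ℝ) k * p) +
      (if D < k then 33 * (p * D) + 18 * ((∑ i ∈ Finset.range p, min (2 ^ i) k : ℕ) : ℝ) else 0) := by
    have : (T : ℝ) ≤ _ := Nat.cast_le.2 hT
    push_cast at this ⊢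
    exact this
  constructor
  · intro hkM
    have hx : Real.logb 2 ((M : ℝ) / k) = Real.logb 2 M - Real.logb 2 k :=
      Real.logb_div hMpos.ne' hkpos.ne'
    set c : ℝ := (⌈Real.logb 2 ((M : ℝ) / (k : ℝ))⌉ : ℝ) with hc
    have hcx : Real.logb 2 M - Real.logb 2 k ≤ c := hx ▸ Int.le_ceil _
    have hc1 : 1 ≤ c := by
      have : 0 < Real.logb 2 ((M : ℝ) / (k : ℝ)) :=
        Real.logb_pos (by norm_num) ((one_lt_div hkpos).2 (by exact_mod_cast hkM))
      have h1 : (1 : ℤ) ≤ ⌈Real.logb 2 ((M : ℝ) / (k : ℝ))⌉ := Int.one_le_ceil_iff.2 this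
      rw [hc]
      exact_mod_cast h1
    have hkR : (1 : ℝ) ≤ k := by exact_mod_cast hk1
    -- From `log₂ M ≤ c + log₂ k`, `log₂ k ≤ lam` and `1 ≤ c`.
    have hp2 : (p : ℝ) ≤ 2 * c + lam := by linarith
    have hcQ : c ≤ k * c := le_mul_of_one_le_left (by linarith) hkR
    -- The minimum is bounded by `k` in front of `c` and by `D` in front of `lam`.
    have hmin : min (D : ℝ) k * p ≤ 2 * (k * c) + D * lam := by
      calc min (D : ℝ) k * p ≤ min (D : ℝ) k * (2 * c + lam) := by gcongr
        _ = 2 * (min (D : ℝ) k * c) + min (D : ℝ) k * lam := by ring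
        _ ≤ 2 * (k * c) + D * lam := by
          gcongr
          · exact min_le_right _ _
          · exact min_le_left _ _
    have hsum : ((∑ i ∈ Finset.range p, min (2 ^ i) k : ℕ) : ℝ) ≤ 4 * (k * c) := by
      have h1 : ((∑ i ∈ Finset.range p, min (2 ^ i) k : ℕ) : ℝ) ≤
          2 * k + k * ((p - (Nat.log 2 k + 1) : ℕ) : ℝ) := by
        exact_mod_cast BeepModel.sum_min_two_pow_le hk1 p
      have h2 : ((p - (Nat.log 2 k + 1) : ℕ) : ℝ) ≤ 2 * c := by
        rcases le_total p (Nat.log 2 k + 1) with h | h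
        · rw [Nat.sub_eq_zero_of_le h]
          push_cast
          linarith
        · rw [Nat.cast_sub h]
          have h3 : Real.logb 2 k ≤ ((Nat.log 2 k + 1 : ℕ) : ℝ) := by
            rw [Real.logb_le_iff_le_rpow (by norm_num) hkpos, Real.rpow_natCast]
            exact_mod_cast (Nat.lt_pow_succ_log_self one_lt_two k).le
          linarith
      calc _ ≤ _ := h1
        _ ≤ 2 * (k * c) + k * (2 * c) := by gcongr; exact le_mul_of_one_le_right hkpos.le hc1
        _ = _ := by ring
    have hkc : 0 ≤ k * c := by positivity
    split_ifs at hTR with hDk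
    -- After an abort the minimum is `D`, so the diameter cost of the `p` search rounds is already
    -- bounded.
    · have hpD : (p : ℝ) * D ≤ 2 * (k * c) + D * lam := by
        rw [min_eq_left (by exact_mod_cast hDk.le)] at hmin
        rwa [mul_comm]
      linarith
    · linarith
  · intro hMk
    have hlogM : Real.logb 2 M ≤ Real.logb 2 k :=
      Real.logb_le_logb_of_le (by norm_num) hMpos (by exact_mod_cast hMk)
    have hp2 : (p : ℝ) ≤ 2 * lam := by linarith
    have hDp : (D : ℝ) * p ≤ 2 * (D * lam) := by
      calc (D : ℝ) * p ≤ D * (2 * lam) := by gcongr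
        _ = _ := by ring
    have hmin : min (D : ℝ) k * p ≤ D * p := by
      gcongr
      exact min_le_left _ _
    have hsum : ((∑ i ∈ Finset.range p, min (2 ^ i) k : ℕ) : ℝ) ≤ 2 * M := by
      have h1 : ∑ i ∈ Finset.range p, min (2 ^ i) k ≤ ∑ i ∈ Finset.range p, 2 ^ i :=
        Finset.sum_le_sum fun i _ => min_le_left _ _
      -- `p` is the length of a number `m < M`, so `2 ^ (p - 1) ≤ m` unless `p = 0`.
      have h2 : 2 ^ p ≤ 2 * M := by
        rcases Nat.eq_zero_or_pos p with h | h
        · rw [h]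
          omega
        · obtain ⟨q, hq⟩ := Nat.exists_eq_succ_of_ne_zero h.ne'
          have : 2 ^ q ≤ m := Nat.lt_size.1 (by omega)
          rw [hq, pow_succ]
          omega
      rw [Nat.geomSum_eq le_rfl] at h1
      have : ∑ i ∈ Finset.range p, min (2 ^ i) k ≤ 2 * M := by omega
      exact_mod_cast this
    split_ifs at hTR with hDk
    · linarith [mul_comm (p : ℝ) D]
    · linarith
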